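/- Let $S$ be a connected Riemann surface with a meromorphic vector field $\partial\not\equiv 0$, let $G$ be a connected complex Lie group, and let $\mathcal R(G)$ be the Lie algebra of right-invariant vector fields on $G$, identified with $T_{Id}G$. Let $f_1,\dots,f_n$ be meromorphic functions on $S$, let $\vec A_1,\dots,\vec A_n\in\mathcal R(G)$, and consider the automorphic system $$\vec A=\partial+\sum_{i=1}^n f_i(t)\,\vec A_i .$$ Let $S^\times$ be the set of points of $S$ that are not poles of any $f_i$ and at which $\partial$ has neither a zero nor a pole (if $\partial$ is holomorphic and nowhere zero, then $S^\times=S\setminus\{\text{poles of the } f_i\}$). For a complex manifold $N$ with a holomorphic action of $G$, let $\vec A^N=\partial+\sum_i f_i(t)\vec A_i^N$ be the induced Lie–Vessiot system, where $\vec A_i^N$ is the fundamental vector field of $\vec A_i$. Let $M$ be a homogeneous $G$-space, and let $x\colon S^\times\to M$ be a holomorphic solution of $\vec A^M$. We call $x$ meromorphic on $S$ if $M$ can be realized, $G$-equivariantly, as an orbit in a product $N\times W$ of a complex manifold $N$ with a holomorphic $G$-action and a finite-dimensional holomorphic representation $W$ of $G$, in such a way that the $N$-component of $x$ extends to a holomorphic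 map $S\to N$ and the $W$-component of $x$ is a meromorphic vector-valued function on $S$. For $t\in S^\times$, the analytic Galois group $\mathrm{Gal}_t(\vec A)\subset G$ is the group of all $\sigma\in G$ such that $\sigma\cdot x(t)=x(t)$ for all meromorphic solutions $x$ of the Lie–Vessiot systems $\vec A^M$ induced in all homogeneous $G$-spaces $M$. Let $Right(\vec A)$ be the set of transversal symmetries of $\vec A$ whose restrictions to the fibres of $S\times G\to S$ are right-invariant and which are meromorphic on $S\times G$; that is, of the vector fields $\vec L$ on $S^\times\times G$ that are tangent to these fibres, satisfy $[\vec L,\vec A]=0$, and restrict to each fibre $\{t\}\times G$ as a right-invariant field $\vec X(t)\in\mathcal R(G)$, where $t\mapsto\vec X(t)$ is holomorphic on $S^\times$ and meromorphic on $S$. Let $Right_t(\vec A)=\{\vec X(t)\}\subset\mathcal R(G)$ be the space of values at $t$ of the elements of $Right(\vec A)$. Theorem. For every $t\in S^\times$, the group $\mathrm{Gal}_t(\vec A)$ is contained in the centralizer of $Right_t(\vec A)$ in $G$, i.e. $\mathrm{Adj}_\sigma(\vec X)=\vec X$ for all $\sigma\in\mathrm{Gal}_t(\vec A)$ and all $\vec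 X\in Right_t(\vec A)$. -/

import Mathlib

open scoped Manifold ContDiff

universe u v

namespace LieVessiot

/-! ### Meromorphic functions, vector fields and maps on a Riemann surface -/

section Meromorphic

/-- The germ at `z` of a meromorphic function given as an honest function: it is meromorphic at `z`
and, unless it has a pole at `z`, it is analytic at `z` (so the value at a point that is not a pole
is the correct one; the value at a pole is irrelevant). -/
def IsMeromorphicGerm (h : ℂ → ℂ) (z : ℂ) : Prop :=
  MeromorphicAt h z ∧ (0 ≤ meromorphicOrderAt h z → AnalyticAt ℂ h z)

variable {S : Type*} [TopologicalSpace S] [ChartedSpace ℂ S]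

/-- The expression of a function on the Riemann surface in the preferred coordinate at `p`. -/
noncomputable def inCoord {W : Type*} (w : S → W) (p : S) : ℂ → W :=
  fun z => w ((chartAt ℂ p).symm z)

/-- The coefficient `c` of a vector field `c(z) d/dz` on the Riemann surface, in the preferred
coordinate `z` at `p`. -/
noncomputable def fieldInCoord (D : ∀ s : S, TangentSpace 𝓘(ℂ, ℂ) s) (p : S) : ℂ → ℂ :=
  fun z => mfderiv 𝓘(ℂ, ℂ) 𝓘(ℂ, ℂ) (chartAt ℂ p) ((chartAt ℂ p).symm z)
    (D ((chartAt ℂ p).symm z))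

/-- A map from the Riemann surface to a complex vector space is meromorphic at `p`
(pole of finite order, removable singularity, or holomorphic). -/
def MeromorphicAtPoint {W : Type*} [NormedAddCommGroup W] [NormedSpace ℂ W]
    (w : S → W) (p : S) : Prop :=
  MeromorphicAt (inCoord w p) (chartAt ℂ p p)

end Meromorphic

/-! ### Right-invariant fields, adjoint action, fundamental fields -/

section Group

variable {E : Type v} [NormedAddCommGroup E] [NormedSpace ℂ E]
  {G : Type u} [TopologicalSpace G] [ChartedSpace E G] [Group G]

/-- The value at `g` of the right-invariant vector field on `G` whose value at the identity
is `X`. The space of right-invariant vector fields is identified with the tangent space at the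
identity. -/
noncomputable def rightInvariantField (X : GroupLieAlgebra 𝓘(ℂ, E) G) (g : G) :
    TangentSpace 𝓘(ℂ, E) g :=
  mfderiv 𝓘(ℂ, E) 𝓘(ℂ, E) (fun h : G => h * g) 1 X

/-- The adjoint action: the tangent map at the identity of `h ↦ g * h * g⁻¹`. -/
noncomputable def Adj (g : G) (X : GroupLieAlgebra 𝓘(ℂ, E) G) : GroupLieAlgebra 𝓘(ℂ, E) G :=
  mfderiv 𝓘(ℂ, E) 𝓘(ℂ, E) (fun h : G => g * h * g⁻¹) 1 X

/-- The centralizer in `G` of a set of elements of its Lie algebra. -/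
def centralizer (R : Set (GroupLieAlgebra 𝓘(ℂ, E) G)) : Set G :=
  {g | ∀ X ∈ R, Adj g X = X}

/-- The value at `x` of the fundamental vector field, on a manifold `N` on which `G` acts by `act`,
of the element `X` of the Lie algebra. -/
noncomputable def fundamentalField {F : Type*} [NormedAddCommGroup F] [NormedSpace ℂ F]
    {N : Type*} [TopologicalSpace N] [ChartedSpace F N]
    (act : G → N → N) (X : GroupLieAlgebra 𝓘(ℂ, E) G) (x : N) : TangentSpace 𝓘(ℂ, F) x :=
  mfderiv 𝓘(ℂ, E) 𝓘(ℂ, F) (fun g : G => act g x) 1 X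

end Group

/-! ### Automorphic systems with meromorphic coefficients -/

/-- An automorphic system `A = ∂ + ∑ i, f i (t) A i` in `G`, depending meromorphically on `S`. -/
structure AutomorphicSystem (S : Type*) [TopologicalSpace S] [ChartedSpace ℂ S]
    (E : Type v) [NormedAddCommGroup E] [NormedSpace ℂ E]
    (G : Type u) [TopologicalSpace G] [ChartedSpace E G] [Group G] where
  /-- The derivation of the Riemann surface, as a vector field. -/
  del : ∀ s : S, TangentSpace 𝓘(ℂ, ℂ) s
  /-- The derivation is meromorphic. -/
  del_meromorphic : ∀ p : S, IsMeromorphicGerm (fieldInCoord del p) (chartAt ℂ p p)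
  /-- The derivation does not vanish identically near any point. -/
  del_ne_zero : ∀ p : S, meromorphicOrderAt (fieldInCoord del p) (chartAt ℂ p p) ≠ ⊤
  /-- The number of terms of the system. -/
  n : ℕ
  /-- The coefficients. -/
  f : Fin n → S → ℂ
  /-- The coefficients are meromorphic functions. -/
  f_meromorphic : ∀ i, ∀ p : S, IsMeromorphicGerm (inCoord (f i) p) (chartAt ℂ p p)
  /-- The right-invariant vector fields. -/
  A : Fin n → GroupLieAlgebra 𝓘(ℂ, E) G

namespace AutomorphicSystem

variable {S : Type*} [TopologicalSpace S] [ChartedSpace ℂ S]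
  {E : Type v} [NormedAddCommGroup E] [NormedSpace ℂ E]
  {G : Type u} [TopologicalSpace G] [ChartedSpace E G] [Group G]

/-- The surface `S^×`: the points of `S` that are not poles of a coefficient and at which the
derivation has neither a zero nor a pole. -/
def regularSet (𝒜 : AutomorphicSystem S E G) : Set S :=
  {t | (∀ i, 0 ≤ meromorphicOrderAt (inCoord (𝒜.f i) t) (chartAt ℂ t t)) ∧
    meromorphicOrderAt (fieldInCoord 𝒜.del t) (chartAt ℂ t t) = 0}

/-- The automorphic system as a vector field on `S × G` (meaningful over `S^×`). -/
noncomputable def field (𝒜 : AutomorphicSystem S E G) (p : S × G) :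
    TangentSpace (𝓘(ℂ, ℂ).prod 𝓘(ℂ, E)) p :=
  (𝒜.del p.1, ∑ i, 𝒜.f i p.1 • rightInvariantField (𝒜.A i) p.2)

/-- `x` is a solution over `S^×` of the Lie-Vessiot system `∂ + ∑ i, f i (t) (A i)^N` induced
in `N`. -/
def IsSolution (𝒜 : AutomorphicSystem S E G)
    {F : Type*} [NormedAddCommGroup F] [NormedSpace ℂ F]
    {N : Type*} [TopologicalSpace N] [ChartedSpace F N]
    (act : G → N → N) (x : S → N) : Prop :=
  (∀ t ∈ 𝒜.regularSet, ContMDiffAt 𝓘(ℂ, ℂ) 𝓘(ℂ, F) ω x t) ∧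
  ∀ t ∈ 𝒜.regularSet,
    (mfderiv 𝓘(ℂ, ℂ) 𝓘(ℂ, F) x t (𝒜.del t) : TangentSpace 𝓘(ℂ, F) (x t)) =
      ∑ i, 𝒜.f i t • fundamentalField (F := F) act (𝒜.A i) (x t)

/-- Meromorphic solutions of the Lie-Vessiot systems induced in homogeneous spaces.

A map from `S^×` to a (usually non-compact) homogeneous space `M` is meromorphic on `S` with
respect to a realization of `M` as an orbit of `G` in a complex `G`-manifold `N × W`, where `N` is
a complex manifold with a holomorphic action of `G` and `W` is a finite-dimensional holomorphic
representation: the component `y` in `N` has to extend holomorphically to `S`, and the component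
`w` in `W` has to be meromorphic on `S`. (Taking for `N` the space `M` itself and `W = 0` gives the
solutions that extend holomorphically to `S → M`; taking `N` a point gives maps into an orbit of a
vector space that have poles.) The function `y` below is the extended map; the values of `w` outside
of `S^×` are irrelevant. -/
structure IsMeromorphicHomogeneousSolution (𝒜 : AutomorphicSystem S E G)
    {F : Type*} [NormedAddCommGroup F] [NormedSpace ℂ F]
    {N : Type*} [TopologicalSpace N] [ChartedSpace F N] [MulAction G N]
    {W : Type*} [NormedAddCommGroup W] [NormedSpace ℂ W] (ρ : G →* (W →L[ℂ] W))
    (y : S → N) (w : S → W) : Prop where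
  /-- `y` solves the Lie-Vessiot system in `N`. -/
  solution_left : 𝒜.IsSolution (F := F) (fun (g : G) (x : N) => g • x) y
  /-- `w` solves the Lie-Vessiot system in `W`. -/
  solution_right : 𝒜.IsSolution (F := W) (fun (g : G) (x : W) => ρ g x) w
  /-- The solution lies in a single orbit of `G`, which is the homogeneous space. -/
  homogeneous : ∃ (y₀ : N) (w₀ : W), ∀ t ∈ 𝒜.regularSet, ∃ g : G, g • y₀ = y t ∧ ρ g w₀ = w t
  /-- `y` is holomorphic on all of `S`. -/
  holomorphic : ContMDiff 𝓘(ℂ, ℂ) 𝓘(ℂ, F) ω y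
  /-- `w` is meromorphic on all of `S`. -/
  meromorphic : ∀ p : S, MeromorphicAtPoint w p

/-- The analytic Galois group of the system at `t`: the elements of `G` that fix the values at `t`
of all meromorphic solutions of all Lie-Vessiot systems induced in homogeneous `G`-spaces. -/
def Gal (𝒜 : AutomorphicSystem S E G) (t : S) : Subgroup G where
  carrier := {g | ∀ (F : Type u) [NormedAddCommGroup F] [NormedSpace ℂ F] [FiniteDimensional ℂ F]
    (N : Type u) [TopologicalSpace N] [ChartedSpace F N] [IsManifold 𝓘(ℂ, F) ω N] [T2Space N]
    [MulAction G N],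
    ContMDiff (𝓘(ℂ, E).prod 𝓘(ℂ, F)) 𝓘(ℂ, F) ω (fun p : G × N => p.1 • p.2) →
    ∀ (W : Type v) [NormedAddCommGroup W] [NormedSpace ℂ W] [FiniteDimensional ℂ W]
    (ρ : G →* (W →L[ℂ] W)), ContMDiff 𝓘(ℂ, E) 𝓘(ℂ, W →L[ℂ] W) ω ρ →
    ∀ (y : S → N) (w : S → W), 𝒜.IsMeromorphicHomogeneousSolution (F := F) ρ y w →
      g • y t = y t ∧ ρ g (w t) = w t}
  one_mem' := by
    intro F _ _ _ N _ _ _ _ _ _ W _ _ _ ρ _ y w _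
    simp
  mul_mem' := by
    intro a b ha hb F _ _ _ N _ _ _ _ _ hN W _ _ _ ρ hρ y w h
    obtain ⟨h1, h2⟩ := ha F N hN W ρ hρ y w h
    obtain ⟨h3, h4⟩ := hb F N hN W ρ hρ y w h
    refine ⟨by rw [mul_smul, h3, h1], ?_⟩
    rw [map_mul, mul_apply_eq_comp, h4, h2]
  inv_mem' := by
    intro a ha F _ _ _ N _ _ _ _ _ hN W _ _ _ ρ hρ y w h
    obtain ⟨h1, h2⟩ := ha F N hN W ρ hρ y w h
    refine ⟨by rw [inv_smul_eq_iff, h1], ?_⟩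
    have h3 : ρ a⁻¹ (ρ a (w t)) = w t := by
      rw [← mul_apply_eq_comp, ← map_mul, inv_mul_cancel, map_one]
      rfl
    rwa [h2] at h3

/-- `L` is a transversal symmetry of the system over `S^×`: it is tangent to the fibres
of `S × G → S` and commutes with the vector field of the system. -/
structure IsTransversalSymmetry (𝒜 : AutomorphicSystem S E G)
    (L : ∀ p : S × G, TangentSpace (𝓘(ℂ, ℂ).prod 𝓘(ℂ, E)) p) : Prop where
  /-- `L` is tangent to the fibres. -/
  transversal : ∀ t ∈ 𝒜.regularSet, ∀ g : G, ((L (t, g) : ℂ × E)).1 = 0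
  /-- `L` commutes with the system. -/
  commutes : ∀ t ∈ 𝒜.regularSet, ∀ g : G,
    VectorField.mlieBracket (𝓘(ℂ, ℂ).prod 𝓘(ℂ, E)) L 𝒜.field (t, g) = 0

/-- The value at the identity of the restriction of a vector field on `S × G` to the fibre
over `t`, as a vector of the model space `E` of the tangent space at the identity. -/
def fibreValue (L : ∀ p : S × G, TangentSpace (𝓘(ℂ, ℂ).prod 𝓘(ℂ, E)) p) (t : S) : E :=
  ((L (t, 1) : ℂ × E)).2

/-- `Right(A)`: the transversal symmetries whose restrictions to the fibres of `S × G → S` are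
right-invariant and which are meromorphic on `S × G`, holomorphic over `S^×`; for a field that is
right-invariant on the fibres this is a condition on its value along the identity section. -/
structure IsRight (𝒜 : AutomorphicSystem S E G)
    (L : ∀ p : S × G, TangentSpace (𝓘(ℂ, ℂ).prod 𝓘(ℂ, E)) p) : Prop where
  /-- `L` is a transversal symmetry. -/
  symmetry : 𝒜.IsTransversalSymmetry L
  /-- The restriction of `L` to each fibre is right-invariant. -/
  right_invariant : ∀ t ∈ 𝒜.regularSet, ∀ g : G,
    ((L (t, g) : ℂ × E)).2 = rightInvariantField (E := E) (G := G) (fibreValue (E := E) L t) g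
  /-- `L` is holomorphic over `S^×`. -/
  holomorphic : ∀ t ∈ 𝒜.regularSet,
    ContMDiffAt 𝓘(ℂ, ℂ) 𝓘(ℂ, E) ω (fibreValue L) t
  /-- `L` is meromorphic on `S`. -/
  meromorphic : ∀ p : S, MeromorphicAtPoint (fibreValue L) p

/-- `Right_t(A)`: the space of values at `t` of the elements of `Right(A)`, right-invariant fields
being identified with their values at the identity. -/
def rightAt (𝒜 : AutomorphicSystem S E G) (t : S) : Set (GroupLieAlgebra 𝓘(ℂ, E) G) :=
  {X | ∃ L, 𝒜.IsRight L ∧ fibreValue L t = X}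

end AutomorphicSystem

end LieVessiot

/-!
Let `L` be a right-invariant transversal symmetry and `X t` its value at the identity of the fibre
over `t`. The proof consists in recognising `X` as a meromorphic solution of a Lie-Vessiot system
in a homogeneous space, namely in an orbit of the adjoint representation of `G` on its Lie algebra.
An element of the Galois group then fixes `X t` under the adjoint action by definition.

* The right-invariant fields with values `X` and `Y` at the identity have the bracket whose value
  there is `-[X, Y]`. Hence `[L, A] = 0` reads `∂X = ∑ fᵢ [Aᵢ, X]`, and the right-hand side is the
  sum of the fundamental fields of the adjoint representation. This is `IsRight.isSolution`; it
  rests on a computation in the chart at the identity (`lieAd_apply`, `lieBracket_rightFrame`) in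
  which the only input is the symmetry of the second derivative of the product of `G`.
* The adjoint representation is holomorphic (`contMDiff_adjointRep`).
* The solution lies in a single orbit (`IsSolution.exists_adjointMap_eq`). Near a point of `S^×`,
  solving the automorphic system itself along real segments gives `g` with `g' = a g`, and
  `Ad g (X t₀)` and `X` solve the same linear equation with the same initial value
  (`eventually_exists_adjointMap_eq`). So the orbit of `X t` is a locally constant function of `t`
  on `S^×`, which is connected because its complement in `S` consists of isolated points
  (`exists_eq_of_locallyConstant_of_nhdsNE`).

The manifold factor of the realization is a point: no factor other than the representation is
needed, since the poles of `X` are poles of a vector-valued function.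
-/

/-! ### Picard–Lindelöf with control of the solution -/

/-- Picard–Lindelöf, with the information that the solution stays in the ball on which the vector
field is controlled. -/
lemma IsPicardLindelof.exists_hasDerivWithinAt_mem_closedBall {E : Type*} [NormedAddCommGroup E]
    [NormedSpace ℝ E] [CompleteSpace E] {f : ℝ → E → E} {tmin tmax : ℝ} {t₀ : Set.Icc tmin tmax}
    {x₀ : E} {a L K : NNReal} (hf : IsPicardLindelof f t₀ x₀ a 0 L K) :
    ∃ α : ℝ → E, α t₀ = x₀ ∧ (∀ t, α t ∈ Metric.closedBall x₀ a) ∧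
      ∀ t ∈ Set.Icc tmin tmax, HasDerivWithinAt α (f t (α t)) (Set.Icc tmin tmax) t := by
  have hx : x₀ ∈ Metric.closedBall x₀ ((0 : NNReal) : ℝ) := Metric.mem_closedBall_self le_rfl
  obtain ⟨α, hα⟩ := ODE.FunSpace.exists_isFixedPt_next hf hx
  refine ⟨α.compProj, by rw [ODE.FunSpace.compProj_val, ← hα, ODE.FunSpace.next_apply₀],
    fun t => α.compProj_mem_closedBall hf.mul_max_le, fun t ht => ?_⟩
  apply ODE.hasDerivWithinAt_picard_Icc t₀.2 hf.continuousOn_uncurry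
    α.continuous_compProj.continuousOn (fun _ _ ↦ α.compProj_mem_closedBall hf.mul_max_le)
    x₀ ht |>.congr_of_mem _ ht
  intro t' ht'
  nth_rw 1 [← hα]
  rw [ODE.FunSpace.compProj_of_mem ht', ODE.FunSpace.next_apply]

namespace LieVessiot

open Filter Topology

/-! ### Tangent maps in preferred coordinates -/

section Charts

variable {H : Type*} [TopologicalSpace H] {M : Type*} [TopologicalSpace M] [ChartedSpace H M]

lemma eventually_chartAt_symm {p x : M} (hx : x ∈ (chartAt H p).source) {P : M → Prop}
    (h : ∀ᶠ y in 𝓝 x, P y) : ∀ᶠ z in 𝓝 (chartAt H p x), P ((chartAt H p).symm z) := by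
  have := (chartAt H p).continuousAt_symm ((chartAt H p).map_source hx)
  rw [ContinuousAt, (chartAt H p).left_inv hx] at this
  exact this.eventually h

lemma eventually_chartAt {p x : M} (hx : x ∈ (chartAt H p).source) {P : H → Prop}
    (h : ∀ᶠ y in 𝓝 (chartAt H p x), P y) : ∀ᶠ z in 𝓝 x, P (chartAt H p z) :=
  ((chartAt H p).continuousAt hx).eventually h

lemma chartAt_symm_chartAt_self (p : M) : (chartAt H p).symm (chartAt H p p) = p :=
  (chartAt H p).left_inv (mem_chart_source H p)

lemma eventually_mem_chart_target (p : M) :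
    ∀ᶠ x in 𝓝 (chartAt H p p), x ∈ (chartAt H p).target :=
  (chartAt H p).open_target.mem_nhds (mem_chart_target H p)

end Charts

section Coordinates

variable {E : Type*} [NormedAddCommGroup E] [NormedSpace ℂ E]
  {M : Type*} [TopologicalSpace M] [ChartedSpace E M]
  {F : Type*} [NormedAddCommGroup F] [NormedSpace ℂ F]
  {N : Type*} [TopologicalSpace N] [ChartedSpace F N]

/-- The tangent map of the preferred chart at `p`, as a map of model spaces. -/
noncomputable def chartDeriv (p x : M) : E →L[ℂ] E :=
  mfderiv 𝓘(ℂ, E) 𝓘(ℂ, E) (chartAt E p) x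

variable [IsManifold 𝓘(ℂ, E) ω M]

lemma chartDeriv_self (p : M) : chartDeriv (E := E) p p = ContinuousLinearMap.id ℂ E :=
  haveI : IsManifold 𝓘(ℂ, E) 1 M := IsManifold.of_le (n := ω) (by simp)
  mfderiv_extChartAt_self (I := 𝓘(ℂ, E)) (x := p)

lemma contMDiffAt_chartAt {p x : M} (hx : x ∈ (chartAt E p).source) :
    ContMDiffAt 𝓘(ℂ, E) 𝓘(ℂ, E) ω (chartAt E p) x :=
  contMDiffAt_extChartAt' (I := 𝓘(ℂ, E)) hx

lemma contMDiffAt_chartAt_symm {p : M} {z : E} (hz : z ∈ (chartAt E p).target) :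
    ContMDiffAt 𝓘(ℂ, E) 𝓘(ℂ, E) ω (chartAt E p).symm z :=
  (contMDiffOn_chart_symm (I := 𝓘(ℂ, E)) (n := ω)).contMDiffAt
    ((chartAt E p).open_target.mem_nhds hz)

lemma contMDiffAt_comp_chartAt_symm {p x : M} {f : M → N}
    (hf : ContMDiffAt 𝓘(ℂ, E) 𝓘(ℂ, F) ω f x) (hx : x ∈ (chartAt E p).source) :
    ContMDiffAt 𝓘(ℂ, E) 𝓘(ℂ, F) ω (fun z => f ((chartAt E p).symm z)) (chartAt E p x) :=
  ContMDiffAt.comp (chartAt E p x) (by rwa [(chartAt E p).left_inv hx])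
    (contMDiffAt_chartAt_symm ((chartAt E p).map_source hx))

/-- The chain rule for a map into a vector space expressed in a chart of the source. -/
lemma mfderiv_eq_fderiv_comp_chartDeriv {p x : M} {f : M → F}
    (hf : ContMDiffAt 𝓘(ℂ, E) 𝓘(ℂ, F) ω f x) (hx : x ∈ (chartAt E p).source) :
    (mfderiv 𝓘(ℂ, E) 𝓘(ℂ, F) f x : E →L[ℂ] F) =
      (fderiv ℂ (fun z => f ((chartAt E p).symm z)) (chartAt E p x)).comp (chartDeriv p x) := by
  have h1 : f =ᶠ[𝓝 x] (fun z => f ((chartAt E p).symm z)) ∘ chartAt E p := by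
    filter_upwards [(chartAt E p).open_source.mem_nhds hx] with y hy
    simp [(chartAt E p).left_inv hy]
  rw [h1.mfderiv_eq]
  have h2 := (contMDiffAt_comp_chartAt_symm hf hx).mdifferentiableAt (by simp)
  have h3 := (contMDiffAt_chartAt hx).mdifferentiableAt (by simp)
  have := mfderiv_comp x h2 h3
  rw [mfderiv_eq_fderiv] at this
  exact this

variable [IsManifold 𝓘(ℂ, F) ω N]

/-- A holomorphic map is holomorphic when expressed in preferred charts. -/
lemma contDiffAt_inCharts {p x : M} {q : N} {f : M → N}
    (hf : ContMDiffAt 𝓘(ℂ, E) 𝓘(ℂ, F) ω f x) (hx : x ∈ (chartAt E p).source)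
    (hfx : f x ∈ (chartAt F q).source) :
    ContDiffAt ℂ ω (fun z => chartAt F q (f ((chartAt E p).symm z))) (chartAt E p x) :=
  (ContMDiffAt.comp (chartAt E p x)
    (contMDiffAt_chartAt (by rwa [(chartAt E p).left_inv hx]))
    (contMDiffAt_comp_chartAt_symm hf hx)).contDiffAt

/-- The chain rule for a map expressed in charts of the source and of the target. -/
lemma chartDeriv_comp_mfderiv {p x : M} {q : N} {f : M → N}
    (hf : ContMDiffAt 𝓘(ℂ, E) 𝓘(ℂ, F) ω f x) (hx : x ∈ (chartAt E p).source)
    (hfx : f x ∈ (chartAt F q).source) :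
    (chartDeriv (E := F) q (f x)).comp (mfderiv 𝓘(ℂ, E) 𝓘(ℂ, F) f x : E →L[ℂ] F) =
      (fderiv ℂ (fun z => chartAt F q (f ((chartAt E p).symm z))) (chartAt E p x)).comp
        (chartDeriv p x) := by
  rw [← mfderiv_eq_fderiv_comp_chartDeriv (f := fun y => chartAt F q (f y))
    (ContMDiffAt.comp x (contMDiffAt_chartAt hfx) hf) hx]
  exact (mfderiv_comp x ((contMDiffAt_chartAt hfx).mdifferentiableAt (by simp))
    (hf.mdifferentiableAt (by simp))).symm

end Coordinates

/-! ### The adjoint representation and invariant fields in the chart at the identity -/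

section ChartGroup

variable {H : Type v} [TopologicalSpace H] {G : Type u} [TopologicalSpace G] [ChartedSpace H G]
  [Group G]

/-- The product of `G` in the preferred chart at the identity. -/
noncomputable def chartMul (G : Type u) [TopologicalSpace G] [ChartedSpace H G] [Group G]
    (x y : H) : H :=
  chartAt H (1 : G) ((chartAt H (1 : G)).symm x * (chartAt H (1 : G)).symm y)

/-- Conjugation by `g` in the preferred chart at the identity. -/
noncomputable def chartConj (g : G) (y : H) : H :=
  chartAt H (1 : G) (g * (chartAt H (1 : G)).symm y * g⁻¹)

lemma chartMul_one_right {x : H} (hx : x ∈ (chartAt H (1 : G)).target) :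
    chartMul G x (chartAt H (1 : G) 1) = x := by
  rw [chartMul, chartAt_symm_chartAt_self, mul_one, (chartAt H (1 : G)).right_inv hx]

lemma chartMul_one_left {x : H} (hx : x ∈ (chartAt H (1 : G)).target) :
    chartMul G (chartAt H (1 : G) 1) x = x := by
  rw [chartMul, chartAt_symm_chartAt_self, one_mul, (chartAt H (1 : G)).right_inv hx]

lemma chartConj_one (g : G) : chartConj g (chartAt H (1 : G) 1) = chartAt H (1 : G) 1 := by
  rw [chartConj, chartAt_symm_chartAt_self, mul_one, mul_inv_cancel]

end ChartGroup

section Adjoint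

variable {E : Type v} [NormedAddCommGroup E] [NormedSpace ℂ E]
  {G : Type u} [TopologicalSpace G] [ChartedSpace E G] [Group G]

/-- Right-invariant fields in the chart at the identity: `rightFrame G x X` is the value at the
point with coordinate `x` of the field with value `X` at the identity. -/
noncomputable def rightFrame (G : Type u) [TopologicalSpace G] [ChartedSpace E G] [Group G]
    (x : E) : E →L[ℂ] E :=
  fderiv ℂ (fun y => chartMul G y x) (chartAt E (1 : G) 1)

/-- Left-invariant fields in the chart at the identity. -/
noncomputable def leftFrame (G : Type u) [TopologicalSpace G] [ChartedSpace E G] [Group G]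
    (x : E) : E →L[ℂ] E :=
  fderiv ℂ (fun y => chartMul G x y) (chartAt E (1 : G) 1)

/-- The adjoint action of `g` as a continuous linear map of the model space. -/
noncomputable def adjointMap (g : G) : E →L[ℂ] E :=
  fderiv ℂ (chartConj g) (chartAt E (1 : G) 1)

/-- The adjoint action of the point of `G` with coordinate `x`. -/
noncomputable def chartAdjoint (G : Type u) [TopologicalSpace G] [ChartedSpace E G] [Group G]
    (x : E) : E →L[ℂ] E :=
  adjointMap ((chartAt E (1 : G)).symm x)

/-- The adjoint representation of the Lie algebra: the derivative at the identity of the adjoint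
representation of the group. -/
noncomputable def lieAd (G : Type u) [TopologicalSpace G] [ChartedSpace E G] [Group G] :
    E →L[ℂ] E →L[ℂ] E :=
  fderiv ℂ (chartAdjoint G) (chartAt E (1 : G) 1)

lemma rightFrame_one : rightFrame G (chartAt E (1 : G) 1) = ContinuousLinearMap.id ℂ E := by
  rw [rightFrame, Filter.EventuallyEq.fderiv_eq (f := id), fderiv_id]
  filter_upwards [eventually_mem_chart_target (1 : G)] with x hx
  simp [chartMul_one_right hx]

lemma adjointMap_one : adjointMap (E := E) (1 : G) = 1 := by
  rw [adjointMap, Filter.EventuallyEq.fderiv_eq (f := id), fderiv_id]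
  · rfl
  filter_upwards [eventually_mem_chart_target (1 : G)] with x hx
  simp [chartConj, (chartAt E (1 : G)).right_inv hx]

variable [LieGroup 𝓘(ℂ, E) ω G]

lemma contMDiffAt_symm_one {x : E} (hx : x ∈ (chartAt E (1 : G)).target) :
    ContMDiffAt 𝓘(ℂ, E) 𝓘(ℂ, E) ω (chartAt E (1 : G)).symm x :=
  contMDiffAt_chartAt_symm hx

lemma contDiffAt_chartMul {x y : E} (hx : x ∈ (chartAt E (1 : G)).target)
    (hy : y ∈ (chartAt E (1 : G)).target)
    (hxy : (chartAt E (1 : G)).symm x * (chartAt E (1 : G)).symm y ∈ (chartAt E (1 : G)).source) :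
    ContDiffAt ℂ ω (fun p : E × E => chartMul G p.1 p.2) (x, y) := by
  have h1 : ContMDiffAt 𝓘(ℂ, E × E) 𝓘(ℂ, E) ω
      (fun p : E × E => (chartAt E (1 : G)).symm p.1) (x, y) :=
    ContMDiffAt.comp (x, y) (contMDiffAt_symm_one hx) contDiffAt_fst.contMDiffAt
  have h2 : ContMDiffAt 𝓘(ℂ, E × E) 𝓘(ℂ, E) ω
      (fun p : E × E => (chartAt E (1 : G)).symm p.2) (x, y) :=
    ContMDiffAt.comp (x, y) (contMDiffAt_symm_one hy) contDiffAt_snd.contMDiffAt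
  exact (ContMDiffAt.comp (x, y) (contMDiffAt_chartAt hxy) (h1.mul h2)).contDiffAt

lemma contDiffAt_chartMul_one :
    ContDiffAt ℂ ω (fun p : E × E => chartMul G p.1 p.2)
      (chartAt E (1 : G) 1, chartAt E (1 : G) 1) :=
  contDiffAt_chartMul (mem_chart_target E 1) (mem_chart_target E 1)
    (by simp)

lemma contDiffAt_chartMul_left {x : E} (hx : x ∈ (chartAt E (1 : G)).target) :
    ContDiffAt ℂ ω (fun y : E => chartMul G y x) (chartAt E (1 : G) 1) := by
  have h := contDiffAt_chartMul (G := G) (mem_chart_target E 1) hx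
    (by simpa [chartAt_symm_chartAt_self] using (chartAt E (1 : G)).map_target hx)
  exact ContDiffAt.comp (g := fun p : E × E => chartMul G p.1 p.2) (chartAt E (1 : G) 1) h
    (contDiffAt_id.prodMk contDiffAt_const)

lemma contDiffAt_rightFrame : ContDiffAt ℂ ω (rightFrame (E := E) G) (chartAt E (1 : G) 1) := by
  refine ContDiffAt.fderiv (n := ω) (f := fun x y => chartMul G y x)
    (g := fun _ => chartAt E (1 : G) 1) ?_ contDiffAt_const (by simp)
  exact ContDiffAt.comp (g := fun p : E × E => chartMul G p.1 p.2)
    (chartAt E (1 : G) 1, chartAt E (1 : G) 1) contDiffAt_chartMul_one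
    (contDiffAt_snd.prodMk contDiffAt_fst)

lemma contMDiff_conj (g : G) : ContMDiff 𝓘(ℂ, E) 𝓘(ℂ, E) ω (fun h : G => g * h * g⁻¹) :=
  (contMDiff_const.mul contMDiff_id).mul contMDiff_const

lemma contDiffAt_chartConj (g : G) : ContDiffAt ℂ ω (chartConj (H := E) g) (chartAt E (1 : G) 1) :=
  contDiffAt_inCharts (contMDiff_conj g 1) (mem_chart_source E 1) (by simp)

lemma contDiffAt_chartAdjoint :
    ContDiffAt ℂ ω (chartAdjoint (E := E) G) (chartAt E (1 : G) 1) := by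
  refine ContDiffAt.fderiv (n := ω)
    (f := fun x y => chartConj ((chartAt E (1 : G)).symm x) y)
    (g := fun _ => chartAt E (1 : G) 1) ?_ contDiffAt_const (by simp)
  set x₀ := chartAt E (1 : G) 1
  have h1 : ContMDiffAt 𝓘(ℂ, E × E) 𝓘(ℂ, E) ω
      (fun p : E × E => (chartAt E (1 : G)).symm p.1) (x₀, x₀) :=
    ContMDiffAt.comp (x₀, x₀) (contMDiffAt_symm_one (mem_chart_target E 1))
      contDiffAt_fst.contMDiffAt
  have h2 : ContMDiffAt 𝓘(ℂ, E × E) 𝓘(ℂ, E) ω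
      (fun p : E × E => (chartAt E (1 : G)).symm p.2) (x₀, x₀) :=
    ContMDiffAt.comp (x₀, x₀) (contMDiffAt_symm_one (mem_chart_target E 1))
      contDiffAt_snd.contMDiffAt
  exact (ContMDiffAt.comp (x₀, x₀) (contMDiffAt_chartAt (by simp [x₀]))
    ((h1.mul h2).mul h1.inv)).contDiffAt

/-- The adjoint action is `adjointMap`, up to the identification of the Lie algebra with the model
space. -/
lemma Adj_eq_adjointMap (g : G) (X : GroupLieAlgebra 𝓘(ℂ, E) G) :
    Adj g X = adjointMap (E := E) g X := by
  have h := chartDeriv_comp_mfderiv (q := (1 : G)) (contMDiff_conj (E := E) g 1)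
    (mem_chart_source E 1) (by simp)
  have e : g * 1 * g⁻¹ = 1 := by simp
  rw [e, chartDeriv_self] at h
  exact congrArg (fun T : E →L[ℂ] E => T X) h

/-- A right-invariant field in the chart at the identity. -/
lemma chartDeriv_rightInvariantField {g : G} (hg : g ∈ (chartAt E (1 : G)).source)
    (X : GroupLieAlgebra 𝓘(ℂ, E) G) :
    chartDeriv (E := E) (1 : G) g (rightInvariantField X g) =
      rightFrame G (chartAt E (1 : G) g) X := by
  have hc : ContMDiff 𝓘(ℂ, E) 𝓘(ℂ, E) ω (fun h : G => h * g) := contMDiff_id.mul contMDiff_const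
  have h := chartDeriv_comp_mfderiv (q := (1 : G)) (hc 1) (mem_chart_source E 1) (by simpa using hg)
  rw [one_mul, chartDeriv_self] at h
  rw [rightFrame]
  simp only [chartMul, (chartAt E (1 : G)).left_inv hg]
  exact congrArg (fun T : E →L[ℂ] E => T X) h

lemma eventually_conj_mem_source (g : G) : ∀ᶠ y in 𝓝 (chartAt E (1 : G) 1),
    g * (chartAt E (1 : G)).symm y * g⁻¹ ∈ (chartAt E (1 : G)).source := by
  refine eventually_chartAt_symm (P := fun h => g * h * g⁻¹ ∈ (chartAt E (1 : G)).source)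
    (mem_chart_source E 1) ?_
  refine (contMDiff_conj (E := E) g).continuous.continuousAt.eventually_mem
    ((chartAt E (1 : G)).open_source.mem_nhds (by simp))

lemma adjointMap_mul (g h : G) :
    adjointMap (E := E) (g * h) = adjointMap g * adjointMap h := by
  have e : chartConj (H := E) (g * h) =ᶠ[𝓝 (chartAt E (1 : G) 1)] chartConj g ∘ chartConj h := by
    filter_upwards [eventually_conj_mem_source h] with y hy
    rw [Function.comp_apply, chartConj, chartConj, chartConj, (chartAt E (1 : G)).left_inv hy,
      mul_inv_rev]
    simp only [mul_assoc]
  have h1 := (contDiffAt_chartConj (E := E) g).differentiableAt (by simp)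
  have h2 := (contDiffAt_chartConj (E := E) h).differentiableAt (by simp)
  rw [adjointMap, e.fderiv_eq, fderiv_comp _ (by rwa [chartConj_one]) h2, chartConj_one]
  rfl

/-- The adjoint representation of `G` on the model space of its Lie algebra. -/
noncomputable def adjointRep (E : Type v) [NormedAddCommGroup E] [NormedSpace ℂ E]
    (G : Type u) [TopologicalSpace G] [ChartedSpace E G] [Group G] [LieGroup 𝓘(ℂ, E) ω G] :
    G →* (E →L[ℂ] E) where
  toFun := adjointMap
  map_one' := adjointMap_one
  map_mul' := adjointMap_mul

lemma contMDiffAt_adjointMap_one : ContMDiffAt 𝓘(ℂ, E) 𝓘(ℂ, E →L[ℂ] E) ω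
    (adjointMap : G → E →L[ℂ] E) 1 := by
  have h : ContMDiffAt 𝓘(ℂ, E) 𝓘(ℂ, E →L[ℂ] E) ω
      (chartAdjoint (E := E) G ∘ chartAt E (1 : G)) 1 :=
    ContMDiffAt.comp 1 contDiffAt_chartAdjoint.contMDiffAt
      (contMDiffAt_chartAt (mem_chart_source E 1))
  refine h.congr_of_eventuallyEq ?_
  filter_upwards [(chartAt E (1 : G)).open_source.mem_nhds (mem_chart_source E 1)] with g hg
  simp [chartAdjoint, (chartAt E (1 : G)).left_inv hg]

/-- The adjoint representation is holomorphic: near `g₀` it is `g ↦ Ad (g g₀⁻¹) ∘ Ad g₀`, so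
holomorphy near the identity is enough. -/
lemma contMDiff_adjointRep : ContMDiff 𝓘(ℂ, E) 𝓘(ℂ, E →L[ℂ] E) ω (adjointRep E G) := by
  intro g₀
  have h1 : ContMDiffAt 𝓘(ℂ, E) 𝓘(ℂ, E) ω (fun g : G => g * g₀⁻¹) g₀ :=
    (contMDiff_id.mul contMDiff_const) g₀
  have h2 : ContMDiffAt 𝓘(ℂ, E) 𝓘(ℂ, E →L[ℂ] E) ω
      (fun g : G => adjointMap (E := E) (g * g₀⁻¹)) g₀ :=
    ContMDiffAt.comp g₀ (by rw [mul_inv_cancel]; exact contMDiffAt_adjointMap_one) h1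
  refine (h2.clm_comp (contMDiffAt_const (c := adjointMap (E := E) g₀))).congr_of_eventuallyEq ?_
  refine Eventually.of_forall fun g => ?_
  have := adjointMap_mul (E := E) (g * g₀⁻¹) g₀
  rw [inv_mul_cancel_right] at this
  exact this

/-- The fundamental fields of the adjoint representation are given by `lieAd`. -/
lemma fundamentalField_adjointRep (X : GroupLieAlgebra 𝓘(ℂ, E) G) (w : E) :
    fundamentalField (F := E) (fun (g : G) (x : E) => adjointRep E G g x) X w =
      lieAd (E := E) G X w := by
  have hc : ContMDiffAt 𝓘(ℂ, E) 𝓘(ℂ, E) ω (fun g : G => adjointRep E G g w) 1 :=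
    (contMDiff_adjointRep 1).clm_apply contMDiffAt_const
  have h := mfderiv_eq_fderiv_comp_chartDeriv hc (mem_chart_source E 1)
  rw [chartDeriv_self] at h
  have h2 := congrArg (fun T : E →L[ℂ] E => T X) h
  refine h2.trans ?_
  have hd := (contDiffAt_chartAdjoint (G := G) (E := E)).differentiableAt (by simp)
  have h3 := (hd.hasFDerivAt.clm_apply (hasFDerivAt_const w _)).fderiv
  refine (congrArg (fun T : E →L[ℂ] E => T X) h3).trans ?_
  simp [lieAd]
  rfl

end Adjoint

/-! ### The bracket of right-invariant fields -/

section Bracket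

variable {E : Type v} [NormedAddCommGroup E] [NormedSpace ℂ E]
  {G : Type u} [TopologicalSpace G] [ChartedSpace E G] [Group G] [LieGroup 𝓘(ℂ, E) ω G]

/-- Left and right translations are related by conjugation, `g h = (g h g⁻¹) g`. -/
lemma rightFrame_comp_chartAdjoint {x : E} (hx : x ∈ (chartAt E (1 : G)).target) :
    (rightFrame G x).comp (chartAdjoint G x) = leftFrame G x := by
  set g := (chartAt E (1 : G)).symm x with hg
  have e : (fun y => chartMul G x y) =ᶠ[𝓝 (chartAt E (1 : G) 1)]
      (fun y => chartMul G y x) ∘ chartConj g := by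
    filter_upwards [eventually_conj_mem_source g] with y hy
    rw [Function.comp_apply, chartMul, chartMul, chartConj, (chartAt E (1 : G)).left_inv hy, ← hg,
      inv_mul_cancel_right]
  have h1 := (contDiffAt_chartMul_left hx).differentiableAt (by simp)
  have h2 := (contDiffAt_chartConj (E := E) g).differentiableAt (by simp)
  rw [leftFrame, e.fderiv_eq, fderiv_comp _ (by rwa [chartConj_one]) h2, chartConj_one]
  rfl

/-- Left-invariant and right-invariant fields commute: in coordinates this is the symmetry of the
mixed second derivative of the product. -/
lemma fderiv_leftFrame_apply (X Y : E) :
    fderiv ℂ (leftFrame G) (chartAt E (1 : G) 1) X Y =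
      fderiv ℂ (rightFrame G) (chartAt E (1 : G) 1) Y X := by
  set x₀ := chartAt E (1 : G) 1 with hx₀
  set m : E × E → E := fun p => chartMul G p.1 p.2 with hm
  have hmc : ContDiffAt ℂ ω m (x₀, x₀) := contDiffAt_chartMul_one
  have hd : ∀ᶠ p in 𝓝 (x₀, x₀), DifferentiableAt ℂ m p := by
    filter_upwards [hmc.eventually (by simp)] with p hp using hp.differentiableAt (by simp)
  have hd2 : HasFDerivAt (fderiv ℂ m) (fderiv ℂ (fderiv ℂ m) (x₀, x₀)) (x₀, x₀) :=
    ((hmc.fderiv_right (m := ω) (by simp)).differentiableAt (by simp)).hasFDerivAt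
  have hl : leftFrame G =ᶠ[𝓝 x₀]
      fun x => (fderiv ℂ m (x, x₀)).comp (ContinuousLinearMap.inr ℂ E E) := by
    have ht : Tendsto (fun x : E => (x, x₀)) (𝓝 x₀) (𝓝 (x₀, x₀)) :=
      (Continuous.prodMk_left x₀).tendsto x₀
    filter_upwards [ht.eventually hd] with x hx
    exact (hx.hasFDerivAt.comp x₀ (hasFDerivAt_prodMk_right x x₀)).fderiv
  have hr : rightFrame G =ᶠ[𝓝 x₀]
      fun x => (fderiv ℂ m (x₀, x)).comp (ContinuousLinearMap.inl ℂ E E) := by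
    have ht : Tendsto (fun x : E => (x₀, x)) (𝓝 x₀) (𝓝 (x₀, x₀)) :=
      (Continuous.prodMk_right x₀).tendsto x₀
    filter_upwards [ht.eventually hd] with x hx
    exact (HasFDerivAt.comp (f := fun e : E => (e, x)) (g := m) x₀ hx.hasFDerivAt
      (hasFDerivAt_prodMk_left x₀ x)).fderiv
  have hl' := ((HasFDerivAt.comp (f := fun e : E => (e, x₀)) (g := fderiv ℂ m) x₀ hd2
    (hasFDerivAt_prodMk_left x₀ x₀)).clm_comp
    (hasFDerivAt_const (ContinuousLinearMap.inr ℂ E E) x₀)).fderiv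
  have hr' := ((hd2.comp x₀ (hasFDerivAt_prodMk_right x₀ x₀)).clm_comp
    (hasFDerivAt_const (ContinuousLinearMap.inl ℂ E E) x₀)).fderiv
  rw [hl.fderiv_eq, hr.fderiv_eq]
  refine (congrArg (fun T : E →L[ℂ] E →L[ℂ] E => T X Y) hl').trans
    (Eq.trans ?_ (congrArg (fun T : E →L[ℂ] E →L[ℂ] E => T Y X) hr').symm)
  simpa using (hmc.isSymmSndFDerivAt (by simp)) (X, 0) (0, Y)

/-- The adjoint representation of the Lie algebra is, up to sign, the bracket of right-invariant
fields. -/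
lemma lieAd_apply (X Y : E) :
    lieAd G X Y = fderiv ℂ (rightFrame G) (chartAt E (1 : G) 1) Y X -
      fderiv ℂ (rightFrame G) (chartAt E (1 : G) 1) X Y := by
  set x₀ := chartAt E (1 : G) 1 with hx₀
  have hr := ((contDiffAt_rightFrame (E := E) (G := G)).differentiableAt (by simp)).hasFDerivAt
  have ha := ((contDiffAt_chartAdjoint (E := E) (G := G)).differentiableAt (by simp)).hasFDerivAt
  have e : leftFrame G =ᶠ[𝓝 x₀] fun x => (rightFrame G x).comp (chartAdjoint G x) := by
    filter_upwards [eventually_mem_chart_target (1 : G)] with x hx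
    exact (rightFrame_comp_chartAdjoint hx).symm
  have h := (hr.clm_comp ha).fderiv
  rw [← e.fderiv_eq] at h
  have h' := congrArg (fun T : E →L[ℂ] E →L[ℂ] E => T X Y) h
  have h1 : chartAdjoint G x₀ = (1 : E →L[ℂ] E) := by
    rw [chartAdjoint, chartAt_symm_chartAt_self, adjointMap_one]
  rw [fderiv_leftFrame_apply] at h'
  rw [rightFrame_one, h1] at h'
  rw [eq_sub_iff_add_eq, h']
  simp [lieAd, hx₀]

/-- The derivative of the adjoint representation along right-invariant fields. -/
lemma eventually_fderiv_chartAdjoint : ∀ᶠ x in 𝓝 (chartAt E (1 : G) 1), ∀ Y : E,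
    fderiv ℂ (chartAdjoint G) x (rightFrame G x Y) = (lieAd G Y).comp (chartAdjoint G x) := by
  filter_upwards [eventually_mem_chart_target (1 : G),
    (contDiffAt_chartAdjoint (E := E) (G := G)).eventually (by simp)] with x hx hax Y
  set x₀ := chartAt E (1 : G) 1 with hx₀
  have hs : ∀ᶠ y in 𝓝 x₀, (chartAt E (1 : G)).symm y * (chartAt E (1 : G)).symm x ∈
      (chartAt E (1 : G)).source := by
    refine eventually_chartAt_symm
      (P := fun h => h * (chartAt E (1 : G)).symm x ∈ (chartAt E (1 : G)).source)
      (mem_chart_source E 1) ?_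
    have hc : ContMDiff 𝓘(ℂ, E) 𝓘(ℂ, E) ω (fun h : G => h * (chartAt E (1 : G)).symm x) :=
      contMDiff_id.mul contMDiff_const
    refine hc.continuous.continuousAt.eventually_mem ((chartAt E (1 : G)).open_source.mem_nhds ?_)
    simpa using (chartAt E (1 : G)).map_target hx
  have e : (fun y => chartAdjoint G (chartMul G y x)) =ᶠ[𝓝 x₀]
      fun y => (chartAdjoint G y).comp (chartAdjoint G x) := by
    filter_upwards [hs] with y hy
    rw [chartAdjoint, chartMul, (chartAt E (1 : G)).left_inv hy, adjointMap_mul]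
    rfl
  have hr := ((contDiffAt_chartMul_left hx).differentiableAt (by simp)).hasFDerivAt
  have ha := (hax.differentiableAt (by simp)).hasFDerivAt
  rw [← chartMul_one_left (G := G) hx] at ha
  have h1 := (ha.comp x₀ hr).fderiv
  have ha0 := ((contDiffAt_chartAdjoint (E := E) (G := G)).differentiableAt (by simp)).hasFDerivAt
  have h2 := (ha0.clm_comp (hasFDerivAt_const (chartAdjoint G x) x₀)).fderiv
  have h3 := h1.symm.trans (e.fderiv_eq.trans h2)
  rw [chartMul_one_left hx] at h3
  have h4 := congrArg (fun T : E →L[ℂ] E →L[ℂ] E => T Y) h3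
  refine Eq.trans h4 ?_
  ext v
  simp [lieAd]

/-- The bracket of the coordinate expressions of a field tangent to the fibres of `S × G → S` and
of a field projectable to `S`, both right-invariant in the direction of `G`. -/
lemma lieBracket_rightFrame {c : ℂ → ℂ} {u b : ℂ → E} {z₀ : ℂ}
    (hu : DifferentiableAt ℂ u z₀) (hb : DifferentiableAt ℂ b z₀) (hc : DifferentiableAt ℂ c z₀) :
    (VectorField.lieBracket ℂ (fun p : ℂ × E => ((0 : ℂ), rightFrame G p.2 (u p.1)))
      (fun p : ℂ × E => (c p.1, rightFrame G p.2 (b p.1))) (z₀, chartAt E (1 : G) 1)).2 =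
      lieAd G (b z₀) (u z₀) - c z₀ • deriv u z₀ := by
  set x₀ := chartAt E (1 : G) 1 with hx₀
  have hr := ((contDiffAt_rightFrame (E := E) (G := G)).differentiableAt (by simp)).hasFDerivAt
  have hr2 := hr.comp (z₀, x₀) (hasFDerivAt_snd (𝕜 := ℂ) (E := ℂ) (F := E) (p := (z₀, x₀)))
  have hfst := hasFDerivAt_fst (𝕜 := ℂ) (E := ℂ) (F := E) (p := (z₀, x₀))
  have hu2 := hu.hasDerivAt.hasFDerivAt.comp (z₀, x₀) hfst
  have hb2 := hb.hasDerivAt.hasFDerivAt.comp (z₀, x₀) hfst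
  have hc2 := hc.hasDerivAt.hasFDerivAt.comp (z₀, x₀) hfst
  have hV := ((hasFDerivAt_const (0 : ℂ) (z₀, x₀)).prodMk (hr2.clm_apply hu2)).fderiv
  have hW := (hc2.prodMk (hr2.clm_apply hb2)).fderiv
  simp only [Function.comp_def] at hV hW
  rw [VectorField.lieBracket, hV, hW, lieAd_apply]
  simp [← hx₀, hx₀ ▸ rightFrame_one (G := G)]
  abel
end Bracket

/-! ### Solutions of the adjoint equation stay in an orbit -/

section Orbit

variable {E : Type v} [NormedAddCommGroup E] [NormedSpace ℂ E] [CompleteSpace E]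
  {G : Type u} [TopologicalSpace G] [ChartedSpace E G] [Group G] [LieGroup 𝓘(ℂ, E) ω G]

/-- The differential equation `x' = a(z)` on the group, with `a(z)` regarded as a right-invariant
field, can be solved along the segments that issue from `z₀`, starting at the identity. -/
lemma eventually_exists_solution_along_segment {a : ℂ → E} {z₀ : ℂ} (ha : ContDiffAt ℂ 1 a z₀)
    {P : E → Prop} (hP : ∀ᶠ x in 𝓝 (chartAt E (1 : G) 1), P x) :
    ∀ᶠ z in 𝓝 z₀, ∃ α : ℝ → E, α 0 = chartAt E (1 : G) 1 ∧ ∀ s ∈ Set.Icc (0 : ℝ) 1, P (α s) ∧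
      HasDerivWithinAt α ((z - z₀) • rightFrame G (α s) (a (z₀ + s • (z - z₀))))
        (Set.Icc 0 1) s := by
  set x₀ := chartAt E (1 : G) 1 with hx₀
  set F : ℂ × E → E := fun p => rightFrame G p.2 (a p.1) with hF
  have hFc : ContDiffAt ℂ 1 F (z₀, x₀) := by
    have h1 : ContDiffAt ℂ 1 (fun p : ℂ × E => rightFrame G p.2) (z₀, x₀) :=
      ContDiffAt.comp (g := rightFrame G) (z₀, x₀)
        ((contDiffAt_rightFrame (E := E) (G := G)).of_le le_top) contDiffAt_snd
    have h2 : ContDiffAt ℂ 1 (fun p : ℂ × E => a p.1) (z₀, x₀) :=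
      ContDiffAt.comp (g := a) (z₀, x₀) ha contDiffAt_fst
    exact h1.clm_apply h2
  obtain ⟨K, t, ht, hK⟩ := hFc.exists_lipschitzOnWith
  have hbd : ∀ᶠ p in 𝓝 (z₀, x₀), ‖F p‖ < ‖F (z₀, x₀)‖ + 1 :=
    hFc.continuousAt.norm.eventually_lt_const (by linarith)
  have hP' : ∀ᶠ p : ℂ × E in 𝓝 (z₀, x₀), P p.2 := continuousAt_snd.eventually hP
  have hall := (hFc.eventually (by simp)).and (hbd.and (hP'.and ht))
  obtain ⟨δ₀, hδ₀, hball⟩ := Metric.eventually_nhds_iff_ball.1 hall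
  set B := ‖F (z₀, x₀)‖ + 1 with hB
  have hBpos : 0 < B := by positivity
  -- the ball for the solution has radius `δ`; for `‖z - z₀‖ ≤ δ / B` it is not left in time `1`
  set δ := δ₀ / 2 with hδ
  have hδpos : 0 < δ := by positivity
  -- `δ` keeps the segments in the domain of the bounds, `1` preserves the Lipschitz constant
  have hε : 0 < min (min δ 1) (δ / B) := by positivity
  filter_upwards [Metric.ball_mem_nhds z₀ hε] with z hz
  rw [mem_ball_iff_norm, lt_min_iff, lt_min_iff] at hz
  obtain ⟨⟨hz1, hz2⟩, hz3⟩ := hz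
  set η := z - z₀ with hη
  have hηB : ‖η‖ * B ≤ δ := by rw [lt_div_iff₀ hBpos] at hz3; exact hz3.le
  have hmem : ∀ s ∈ Set.Icc (0 : ℝ) 1, ∀ x ∈ Metric.closedBall x₀ δ,
      (z₀ + s • η, x) ∈ Metric.ball (z₀, x₀) δ₀ := by
    intro s hs x hx
    rw [← ball_prod_same, Set.mem_prod]
    constructor
    · have h1 : ‖s • η‖ ≤ 1 * ‖η‖ := by
        rw [norm_smul, Real.norm_of_nonneg hs.1]
        exact mul_le_mul_of_nonneg_right hs.2 (norm_nonneg _)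
      simp only [mem_ball_iff_norm, add_sub_cancel_left]
      linarith
    · exact Metric.closedBall_subset_ball (by linarith) hx
  have hPL : IsPicardLindelof (fun s x => η • F (z₀ + s • η, x))
      (⟨0, by simp⟩ : Set.Icc (0 : ℝ) 1) x₀ (.mk δ hδpos.le) 0 (.mk δ hδpos.le) K := by
    refine ⟨fun s hs => ?_, fun x hx => ?_, fun s hs x hx => ?_, by simp⟩
    · refine LipschitzOnWith.of_dist_le_mul fun x hx y hy => ?_
      have h1 := hK.dist_le_mul _ (hball _ (hmem s hs x hx)).2.2.2 _
        (hball _ (hmem s hs y hy)).2.2.2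
      have h2 : dist (z₀ + s • η, x) (z₀ + s • η, y) = dist x y := by simp [Prod.dist_eq]
      rw [h2] at h1
      rw [dist_smul₀]
      exact (mul_le_of_le_one_left dist_nonneg hz2.le).trans h1
    · intro s hs
      have h1 := (hball _ (hmem s hs x hx)).1.continuousAt
      have h2 : ContinuousAt (fun s : ℝ => (z₀ + s • η, x)) s := by fun_prop
      have h3 := ContinuousAt.comp (f := fun s : ℝ => (z₀ + s • η, x)) (g := F) h1 h2
      exact (h3.const_smul η).continuousWithinAt
    · rw [norm_smul]
      exact (mul_le_mul_of_nonneg_left (hball _ (hmem s hs x hx)).2.1.le (norm_nonneg _)).trans hηB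
  obtain ⟨α, hα0, hαm, hα⟩ := hPL.exists_hasDerivWithinAt_mem_closedBall
  exact ⟨α, hα0, fun s hs => ⟨(hball _ (hmem s hs _ (hαm s))).2.2.1, hα s hs⟩⟩

/-- A solution of `u' = [a, u]` remains, locally, in an orbit of the adjoint representation: if `g`
solves `g' = a` on the group, then `u` and `Ad g (u z₀)` solve the same linear equation. -/
lemma eventually_exists_adjointMap_eq {a u : ℂ → E} {z₀ : ℂ} (ha : ContDiffAt ℂ 1 a z₀)
    (hu : ∀ᶠ z in 𝓝 z₀, HasDerivAt u (lieAd G (a z) (u z)) z) :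
    ∀ᶠ z in 𝓝 z₀, ∃ g : G, adjointMap g (u z₀) = u z := by
  have hbd : ∀ᶠ z in 𝓝 z₀, ‖a z‖ < ‖a z₀‖ + 1 :=
    ha.continuousAt.norm.eventually_lt_const (by linarith)
  obtain ⟨ε, hε, hball⟩ := Metric.eventually_nhds_iff_ball.1 (hu.and hbd)
  have hdiff : ∀ᶠ x in 𝓝 (chartAt E (1 : G) 1), DifferentiableAt ℂ (chartAdjoint G) x := by
    filter_upwards [(contDiffAt_chartAdjoint (E := E) (G := G)).eventually (by simp)] with x hx
    exact hx.differentiableAt (by simp)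
  filter_upwards [Metric.ball_mem_nhds z₀ hε, eventually_exists_solution_along_segment ha
    (hdiff.and (eventually_fderiv_chartAdjoint (G := G)))] with z hz ⟨α, hα0, hα⟩
  set η := z - z₀ with hη
  have hmem : ∀ s ∈ Set.Icc (0 : ℝ) 1, z₀ + s • η ∈ Metric.ball z₀ ε := by
    intro s hs
    have h1 : ‖s • η‖ ≤ 1 * ‖η‖ := by
      rw [norm_smul, Real.norm_of_nonneg hs.1]
      exact mul_le_mul_of_nonneg_right hs.2 (norm_nonneg _)
    rw [mem_ball_iff_norm] at hz ⊢
    rw [add_sub_cancel_left]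
    linarith
  have hU : ∀ s ∈ Set.Icc (0 : ℝ) 1, HasDerivWithinAt (fun s => chartAdjoint G (α s) (u z₀))
      (η • lieAd G (a (z₀ + s • η)) (chartAdjoint G (α s) (u z₀))) (Set.Icc 0 1) s := by
    intro s hs
    obtain ⟨⟨h1, h2⟩, h3⟩ := hα s hs
    have h4 := (h1.hasFDerivAt.clm_apply (hasFDerivAt_const (u z₀) (α s))).restrictScalars ℝ
    refine (h4.comp_hasDerivWithinAt s h3).congr_deriv ?_
    change chartAdjoint G (α s) 0 + fderiv ℂ (chartAdjoint G) (α s) (η • _) (u z₀) = _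
    rw [map_smul, h2, map_zero, zero_add]
    rfl
  have hv : ∀ s ∈ Set.Icc (0 : ℝ) 1, HasDerivWithinAt (fun s : ℝ => u (z₀ + s • η))
      (η • lieAd G (a (z₀ + s • η)) (u (z₀ + s • η))) (Set.Icc 0 1) s := by
    intro s hs
    have h1 := (hball _ (hmem s hs)).1.hasFDerivAt.restrictScalars ℝ
    have h2 : HasDerivAt (fun s : ℝ => z₀ + s • η) η s := by
      simpa using ((hasDerivAt_id s).smul_const η).const_add z₀
    exact (h1.comp_hasDerivWithinAt s h2.hasDerivWithinAt).congr_deriv rfl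
  have hIci : ∀ s ∈ Set.Ico (0 : ℝ) 1, Set.Icc (0 : ℝ) 1 ∈ 𝓝[Set.Ici s] s :=
    fun s hs => Icc_mem_nhdsGE_of_mem hs
  have key := ODE_solution_unique_of_mem_Icc_right
    (v := fun s w => η • lieAd G (a (z₀ + s • η)) w) (s := fun _ => Set.univ)
    (K := .mk (‖η‖ * (‖lieAd (E := E) G‖ * (‖a z₀‖ + 1))) (by positivity))
    (fun s hs => by
      refine LipschitzOnWith.of_dist_le_mul fun x _ y _ => ?_
      rw [dist_smul₀, dist_eq_norm, ← map_sub, dist_eq_norm, NNReal.coe_mk, mul_assoc]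
      refine mul_le_mul_of_nonneg_left ?_ (norm_nonneg _)
      refine (ContinuousLinearMap.le_opNorm₂ _ _ _).trans ?_
      gcongr
      exact (hball _ (hmem s (Set.Ico_subset_Icc_self hs))).2.le)
    (fun s hs => (hU s hs).continuousWithinAt)
    (fun s hs => (hU s (Set.Ico_subset_Icc_self hs)).mono_of_mem_nhdsWithin (hIci s hs))
    (fun _ _ => trivial)
    (fun s hs => (hv s hs).continuousWithinAt)
    (fun s hs => (hv s (Set.Ico_subset_Icc_self hs)).mono_of_mem_nhdsWithin (hIci s hs))
    (fun _ _ => trivial)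
    (by simp [hα0, chartAdjoint, adjointMap_one])
  refine ⟨(chartAt E (1 : G)).symm (α 1), ?_⟩
  have := key (Set.right_mem_Icc.2 zero_le_one)
  simpa [chartAdjoint, hη] using this

end Orbit

/-! ### Removing isolated points from a connected surface -/

section PuncturedNhds

lemma isPreconnected_ball_diff_center (z : ℂ) (r : ℝ) :
    IsPreconnected (Metric.ball z r \ {z}) := by
  rcases le_or_gt r 0 with hr | hr
  · simp [Metric.ball_eq_empty.2 hr, isPreconnected_empty]
  -- the punctured disc is the image of a half plane under the exponential map
  have h : Metric.ball z r \ {z} = (fun w => z + Complex.exp w) '' {w | w.re < Real.log r} := by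
    ext w
    simp only [Set.mem_sdiff, mem_ball_iff_norm, Set.mem_singleton_iff, Set.mem_image,
      Set.mem_ofPred_eq]
    constructor
    · rintro ⟨h1, h2⟩
      have h3 : w - z ≠ 0 := sub_ne_zero.2 h2
      refine ⟨Complex.log (w - z), ?_, by rw [Complex.exp_log h3]; ring⟩
      rw [Complex.log_re]
      exact Real.log_lt_log (norm_pos_iff.2 h3) h1
    · rintro ⟨x, hx, rfl⟩
      refine ⟨?_, by simp [Complex.exp_ne_zero]⟩
      rw [add_sub_cancel_left, Complex.norm_exp]
      exact (Real.lt_log_iff_exp_lt hr).1 hx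
  rw [h]
  exact (convex_halfSpace_re_lt _).isPreconnected.image _ (by fun_prop)

variable {S : Type*} [TopologicalSpace S] [ChartedSpace ℂ S]

lemma neBot_nhdsNE_of_chartedSpace (p : S) : (𝓝[≠] p).NeBot := by
  refine ⟨fun h => ?_⟩
  rw [← isOpen_singleton_iff_punctured_nhds] at h
  have h1 := (chartAt ℂ p).isOpen_image_of_subset_source h
    (Set.singleton_subset_iff.2 (mem_chart_source ℂ p))
  rw [Set.image_singleton] at h1
  exact not_isOpen_singleton _ h1

lemma tendsto_chartAt_nhdsNE (p : S) :
    Tendsto (chartAt ℂ p) (𝓝[≠] p) (𝓝[≠] (chartAt ℂ p p)) := by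
  refine tendsto_nhdsWithin_iff.2
    ⟨((chartAt ℂ p).continuousAt (mem_chart_source ℂ p)).tendsto.mono_left nhdsWithin_le_nhds, ?_⟩
  filter_upwards [self_mem_nhdsWithin, nhdsWithin_le_nhds
    ((chartAt ℂ p).open_source.mem_nhds (mem_chart_source ℂ p))] with q hq hqs h
  exact hq ((chartAt ℂ p).injOn hqs (mem_chart_source ℂ p) h)

lemma tendsto_chartAt_symm_nhdsNE (p : S) :
    Tendsto (chartAt ℂ p).symm (𝓝[≠] (chartAt ℂ p p)) (𝓝[≠] p) := by
  have h := (chartAt ℂ p).continuousAt_symm (mem_chart_target ℂ p)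
  rw [ContinuousAt, chartAt_symm_chartAt_self] at h
  refine tendsto_nhdsWithin_iff.2 ⟨h.mono_left nhdsWithin_le_nhds, ?_⟩
  filter_upwards [self_mem_nhdsWithin, nhdsWithin_le_nhds
    (eventually_mem_chart_target p)] with z hz hzt h
  exact hz (by rw [← (chartAt ℂ p).right_inv hzt, h]; rfl)

/-- A connected surface stays connected when a set of isolated points is removed, in the form: a
function that is locally constant off such a set is constant there. -/
lemma exists_eq_of_locallyConstant_of_nhdsNE [ConnectedSpace S] {X : Type*} {U : Set S} {φ : S → X}
    (hU : ∀ p, ∀ᶠ q in 𝓝[≠] p, q ∈ U) (hφ : ∀ t ∈ U, ∀ᶠ s in 𝓝 t, φ s = φ t) :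
    ∃ x, ∀ t ∈ U, φ t = x := by
  have hloc : ∀ p, ∃ x, ∀ᶠ q in 𝓝[≠] p, q ∈ U ∧ φ q = x := by
    intro p
    have h1 := ((tendsto_chartAt_symm_nhdsNE p).eventually (hU p)).and
      (eventually_nhdsWithin_of_eventually_nhds (eventually_mem_chart_target p))
    rw [eventually_nhdsWithin_iff, Metric.eventually_nhds_iff_ball] at h1
    obtain ⟨r, hr, hb⟩ := h1
    have hpc := isPreconnected_ball_diff_center (chartAt ℂ p p) r
    -- a locally constant function is a continuous function into a discrete space
    let : TopologicalSpace X := ⊥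
    have : DiscreteTopology X := ⟨rfl⟩
    have hc : ContinuousOn (fun z => φ ((chartAt ℂ p).symm z))
        (Metric.ball (chartAt ℂ p p) r \ {chartAt ℂ p p}) := by
      intro z hz
      obtain ⟨h2, h3⟩ := hb z hz.1 hz.2
      refine ContinuousAt.continuousWithinAt ?_
      have h4 := ((chartAt ℂ p).continuousAt_symm h3).eventually (hφ _ h2)
      exact (continuousAt_const (y := φ ((chartAt ℂ p).symm z))).congr
        (h4.mono fun y hy => hy.symm)
    have hev : ∀ᶠ z in 𝓝[≠] (chartAt ℂ p p), z ∈ Metric.ball (chartAt ℂ p p) r \ {chartAt ℂ p p} :=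
      inter_mem (nhdsWithin_le_nhds (Metric.ball_mem_nhds _ hr)) self_mem_nhdsWithin
    obtain ⟨z₁, hz₁⟩ := hev.exists
    refine ⟨φ ((chartAt ℂ p).symm z₁), ?_⟩
    filter_upwards [(tendsto_chartAt_nhdsNE p).eventually hev, nhdsWithin_le_nhds
      ((chartAt ℂ p).open_source.mem_nhds (mem_chart_source ℂ p)), hU p] with q hq hqs hqU
    refine ⟨hqU, ?_⟩
    simpa [(chartAt ℂ p).left_inv hqs] using hpc.constant hc hq hz₁
  -- `o p` is the value of `φ` near `p`, also at the points `p` outside of `U`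
  choose o ho using hloc
  have hoU : ∀ t ∈ U, o t = φ t := by
    intro t ht
    have := neBot_nhdsNE_of_chartedSpace t
    obtain ⟨q, hq, hq'⟩ := ((ho t).and
      (eventually_nhdsWithin_of_eventually_nhds (hφ t ht))).exists
    exact hq.2.symm.trans hq'
  have hlc : IsLocallyConstant o := by
    rw [IsLocallyConstant.iff_eventually_eq]
    intro p
    rw [← pure_sup_nhdsNE, eventually_sup]
    exact ⟨by simp, (ho p).mono fun q hq => (hoU q hq.1).trans hq.2⟩
  obtain ⟨p⟩ := ConnectedSpace.toNonempty (α := S)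
  exact ⟨o p, fun t ht => (hoU t ht).symm.trans (hlc.apply_eq_of_preconnectedSpace t p)⟩

end PuncturedNhds

/-! ### The regular set of an automorphic system -/

namespace AutomorphicSystem

variable {S : Type*} [TopologicalSpace S] [ChartedSpace ℂ S]
  {E : Type v} [NormedAddCommGroup E] [NormedSpace ℂ E]
  {G : Type u} [TopologicalSpace G] [ChartedSpace E G] [Group G]

lemma contDiffAt_f (𝒜 : AutomorphicSystem S E G) {t : S} (ht : t ∈ 𝒜.regularSet) (i : Fin 𝒜.n) :
    ContDiffAt ℂ ω (inCoord (𝒜.f i) t) (chartAt ℂ t t) :=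
  AnalyticAt.contDiffAt ((𝒜.f_meromorphic i t).2 (ht.1 i))

lemma contDiffAt_del (𝒜 : AutomorphicSystem S E G) {t : S} (ht : t ∈ 𝒜.regularSet) :
    ContDiffAt ℂ ω (fieldInCoord 𝒜.del t) (chartAt ℂ t t) :=
  AnalyticAt.contDiffAt ((𝒜.del_meromorphic t).2 ht.2.ge)

lemma fieldInCoord_del_ne_zero (𝒜 : AutomorphicSystem S E G) {t : S} (ht : t ∈ 𝒜.regularSet) :
    fieldInCoord 𝒜.del t (chartAt ℂ t t) ≠ 0 := by
  have h1 := (𝒜.del_meromorphic t).2 ht.2.ge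
  have h2 := ht.2
  rw [h1.meromorphicOrderAt_eq] at h2
  rw [← h1.analyticOrderAt_eq_zero]
  cases h : analyticOrderAt (fieldInCoord 𝒜.del t) (chartAt ℂ t t) with
  | top => simp [h] at h2
  | coe n => simpa [h] using h2

end AutomorphicSystem

section RegularSet

variable {S : Type*} [TopologicalSpace S] [ChartedSpace ℂ S]

lemma fieldInCoord_chartAt (D : ∀ s : S, TangentSpace 𝓘(ℂ, ℂ) s) {p s : S}
    (hs : s ∈ (chartAt ℂ p).source) :
    fieldInCoord D p (chartAt ℂ p s) = chartDeriv (E := ℂ) p s (D s) := by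
  rw [fieldInCoord, (chartAt ℂ p).left_inv hs]
  rfl

variable [IsManifold 𝓘(ℂ, ℂ) ω S]

lemma contDiffAt_transition {p q s : S} (hp : s ∈ (chartAt ℂ p).source)
    (hq : s ∈ (chartAt ℂ q).source) :
    ContDiffAt ℂ ω (fun z => chartAt ℂ p ((chartAt ℂ q).symm z)) (chartAt ℂ q s) :=
  contDiffAt_inCharts (f := fun s : S => s) contMDiffAt_id hq hp

lemma contDiffAt_inCoord_of_mem_source {W : Type*} [NormedAddCommGroup W] [NormedSpace ℂ W]
    {f : S → W} {p q : S} (hq : q ∈ (chartAt ℂ p).source)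
    (hf : ContDiffAt ℂ ω (inCoord f p) (chartAt ℂ p q)) :
    ContDiffAt ℂ ω (inCoord f q) (chartAt ℂ q q) := by
  have h1 := contDiffAt_transition hq (mem_chart_source ℂ q)
  have h2 : ContDiffAt ℂ ω (inCoord f p ∘ fun z => chartAt ℂ p ((chartAt ℂ q).symm z))
      (chartAt ℂ q q) :=
    ContDiffAt.comp _ (by rwa [chartAt_symm_chartAt_self]) h1
  refine h2.congr_of_eventuallyEq ?_
  filter_upwards [eventually_chartAt_symm (mem_chart_source ℂ q)
    ((chartAt ℂ p).open_source.eventually_mem hq)] with z hz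
  simp [inCoord, (chartAt ℂ p).left_inv hz]

lemma fieldInCoord_self (D : ∀ s : S, TangentSpace 𝓘(ℂ, ℂ) s) (q : S) :
    fieldInCoord D q (chartAt ℂ q q) = D q := by
  rw [fieldInCoord_chartAt D (mem_chart_source ℂ q), chartDeriv_self]
  rfl

lemma contDiffAt_fieldInCoord_of_mem_source {D : ∀ s : S, TangentSpace 𝓘(ℂ, ℂ) s} {p q : S}
    (hq : q ∈ (chartAt ℂ p).source)
    (hf : ContDiffAt ℂ ω (fieldInCoord D p) (chartAt ℂ p q)) :
    ContDiffAt ℂ ω (fieldInCoord D q) (chartAt ℂ q q) := by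
  have h1 := contDiffAt_transition hq (mem_chart_source ℂ q)
  have h2 : ContDiffAt ℂ ω (fieldInCoord D p ∘ fun z => chartAt ℂ p ((chartAt ℂ q).symm z))
      (chartAt ℂ q q) :=
    ContDiffAt.comp _ (by rwa [chartAt_symm_chartAt_self]) h1
  have h3 := (contDiffAt_transition (mem_chart_source ℂ q) hq).fderiv_right (m := ω) (by simp)
  have h4 : ContDiffAt ℂ ω
      (fderiv ℂ (fun z => chartAt ℂ q ((chartAt ℂ p).symm z)) ∘
        fun z => chartAt ℂ p ((chartAt ℂ q).symm z)) (chartAt ℂ q q) :=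
    ContDiffAt.comp _ (by rwa [chartAt_symm_chartAt_self]) h1
  refine (h4.clm_apply h2).congr_of_eventuallyEq ?_
  filter_upwards [eventually_chartAt_symm (mem_chart_source ℂ q)
    ((chartAt ℂ p).open_source.eventually_mem hq), eventually_mem_chart_target q] with z hz hzt
  obtain ⟨s, hs, rfl⟩ : ∃ s ∈ (chartAt ℂ q).source, chartAt ℂ q s = z :=
    ⟨_, (chartAt ℂ q).map_target hzt, (chartAt ℂ q).right_inv hzt⟩
  rw [(chartAt ℂ q).left_inv hs] at hz
  have h5 := mfderiv_eq_fderiv_comp_chartDeriv (contMDiffAt_chartAt hs) hz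
  rw [fieldInCoord_chartAt D hs, Function.comp_apply, Function.comp_apply,
    (chartAt ℂ q).left_inv hs, fieldInCoord_chartAt D hz]
  exact congrArg (fun T : ℂ →L[ℂ] ℂ => T (D s)) h5

lemma fieldInCoord_ne_zero_of_mem_source {D : ∀ s : S, TangentSpace 𝓘(ℂ, ℂ) s} {p q : S}
    (hq : q ∈ (chartAt ℂ p).source) (hf : fieldInCoord D p (chartAt ℂ p q) ≠ 0) :
    fieldInCoord D q (chartAt ℂ q q) ≠ 0 := by
  rw [fieldInCoord_self]
  intro h
  apply hf
  rw [fieldInCoord_chartAt D hq, h]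
  exact map_zero (chartDeriv (E := ℂ) p q)

variable {E : Type v} [NormedAddCommGroup E] [NormedSpace ℂ E]
  {G : Type u} [TopologicalSpace G] [ChartedSpace E G] [Group G]

namespace AutomorphicSystem

lemma mem_regularSet_of_contDiffAt (𝒜 : AutomorphicSystem S E G) {p q : S}
    (hq : q ∈ (chartAt ℂ p).source)
    (hf : ∀ i, ContDiffAt ℂ ω (inCoord (𝒜.f i) p) (chartAt ℂ p q))
    (hd : ContDiffAt ℂ ω (fieldInCoord 𝒜.del p) (chartAt ℂ p q))
    (h0 : fieldInCoord 𝒜.del p (chartAt ℂ p q) ≠ 0) : q ∈ 𝒜.regularSet := by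
  refine ⟨fun i => ?_, ?_⟩
  · exact (contDiffAt_inCoord_of_mem_source hq (hf i)).analyticAt.meromorphicOrderAt_nonneg
  · have h1 := (contDiffAt_fieldInCoord_of_mem_source hq hd).analyticAt
    rw [h1.meromorphicOrderAt_eq,
      h1.analyticOrderAt_eq_zero.2 (fieldInCoord_ne_zero_of_mem_source hq h0)]
    rfl

/-- The points outside of `S^×` are isolated. -/
lemma eventually_nhdsNE_mem_regularSet (𝒜 : AutomorphicSystem S E G) (p : S) :
    ∀ᶠ q in 𝓝[≠] p, q ∈ 𝒜.regularSet := by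
  have h1 : ∀ᶠ z in 𝓝[≠] (chartAt ℂ p p), ∀ i, AnalyticAt ℂ (inCoord (𝒜.f i) p) z :=
    eventually_all.2 fun i => (𝒜.f_meromorphic i p).1.eventually_analyticAt
  have h2 := (𝒜.del_meromorphic p).1.eventually_analyticAt
  have h3 := (meromorphicOrderAt_ne_top_iff_eventually_ne_zero (𝒜.del_meromorphic p).1).1
    (𝒜.del_ne_zero p)
  filter_upwards [(tendsto_chartAt_nhdsNE p).eventually (h1.and (h2.and h3)), nhdsWithin_le_nhds
    ((chartAt ℂ p).open_source.mem_nhds (mem_chart_source ℂ p))] with q hq hqs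
  exact 𝒜.mem_regularSet_of_contDiffAt hqs
    (fun i => (hq.1 i).contDiffAt)
    hq.2.1.contDiffAt hq.2.2

lemma eventually_mem_regularSet (𝒜 : AutomorphicSystem S E G) {t : S} (ht : t ∈ 𝒜.regularSet) :
    ∀ᶠ q in 𝓝 t, q ∈ 𝒜.regularSet := by
  rw [← pure_sup_nhdsNE, eventually_sup]
  exact ⟨by simpa using ht, 𝒜.eventually_nhdsNE_mem_regularSet t⟩

end AutomorphicSystem

end RegularSet

/-! ### Transversal symmetries solve the adjoint Lie–Vessiot system -/

section BracketInChart

variable {V : Type*} [NormedAddCommGroup V] [NormedSpace ℂ V] {H : Type*} [TopologicalSpace H]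
  {I : ModelWithCorners ℂ V H} {M : Type*} [TopologicalSpace M] [ChartedSpace H M]
  [IsManifold I 1 M]

/-- The coordinate expression of a vector field in the preferred chart at `p`. -/
lemma mpullbackWithin_extChartAt_symm {p : M} (X : ∀ q : M, TangentSpace I q) {y : V}
    (hy : y ∈ (extChartAt I p).target) :
    VectorField.mpullbackWithin 𝓘(ℂ, V) I (extChartAt I p).symm X (Set.range I) y =
      mfderiv I 𝓘(ℂ, V) (extChartAt I p) ((extChartAt I p).symm y)
        (X ((extChartAt I p).symm y)) := by
  rw [VectorField.mpullbackWithin_apply, ContinuousLinearMap.inverse_eq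
    (mfderivWithin_extChartAt_symm_comp_mfderiv_extChartAt hy)
    (mfderiv_extChartAt_comp_mfderivWithin_extChartAt_symm hy)]
  rfl

/-- If the bracket of two fields vanishes, so does that of their coordinate expressions. -/
lemma lieBracket_eq_zero_of_mlieBracket_eq_zero [I.Boundaryless] {p : M}
    {X Y : ∀ q : M, TangentSpace I q}
    (h : VectorField.mlieBracket I X Y p = 0) {X' Y' : V → V}
    (hX : ∀ᶠ y in 𝓝 (extChartAt I p p), X' y = mfderiv I 𝓘(ℂ, V) (extChartAt I p)
      ((extChartAt I p).symm y) (X ((extChartAt I p).symm y)))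
    (hY : ∀ᶠ y in 𝓝 (extChartAt I p p), Y' y = mfderiv I 𝓘(ℂ, V) (extChartAt I p)
      ((extChartAt I p).symm y) (Y ((extChartAt I p).symm y))) :
    VectorField.lieBracket ℂ X' Y' (extChartAt I p p) = 0 := by
  have ht : (extChartAt I p).target ∈ 𝓝 (extChartAt I p p) := extChartAt_target_mem_nhds p
  have hX' : X' =ᶠ[𝓝 (extChartAt I p p)] VectorField.mpullbackWithin 𝓘(ℂ, V) I
      (extChartAt I p).symm X (Set.range I) := by
    filter_upwards [hX, ht] with y h1 h2 using h1.trans (mpullbackWithin_extChartAt_symm X h2).symm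
  have hY' : Y' =ᶠ[𝓝 (extChartAt I p p)] VectorField.mpullbackWithin 𝓘(ℂ, V) I
      (extChartAt I p).symm Y (Set.range I) := by
    filter_upwards [hY, ht] with y h1 h2 using h1.trans (mpullbackWithin_extChartAt_symm Y h2).symm
  rw [hX'.lieBracket_vectorField_eq hY']
  have h1 := VectorField.mlieBracketWithin_apply (I := I) (V := X) (W := Y) (s := Set.univ)
    (x₀ := p)
  rw [VectorField.mlieBracketWithin_univ, h, Set.preimage_univ, Set.univ_inter,
    I.range_eq_univ] at h1
  obtain ⟨T, hT⟩ := isInvertible_mfderiv_extChartAt (I := I) (mem_extChartAt_source (I := I) p)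
  rw [← hT, ContinuousLinearMap.inverse_equiv] at h1
  rw [I.range_eq_univ]
  refine (congrFun (VectorField.lieBracketWithin_univ (𝕜 := ℂ)) _).symm.trans ?_
  exact (map_eq_zero_iff T.symm T.symm.injective).1 h1.symm

end BracketInChart

section ProductChart

variable {S : Type*} [TopologicalSpace S] [ChartedSpace ℂ S] [IsManifold 𝓘(ℂ, ℂ) ω S]
  {E : Type v} [NormedAddCommGroup E] [NormedSpace ℂ E]
  {G : Type u} [TopologicalSpace G] [ChartedSpace E G] [IsManifold 𝓘(ℂ, E) ω G]

lemma mfderiv_extChartAt_prod_apply {p q : S × G} (h1 : q.1 ∈ (chartAt ℂ p.1).source)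
    (h2 : q.2 ∈ (chartAt E p.2).source) (X : ℂ × E) :
    (mfderiv (𝓘(ℂ, ℂ).prod 𝓘(ℂ, E)) 𝓘(ℂ, ℂ × E) (extChartAt (𝓘(ℂ, ℂ).prod 𝓘(ℂ, E)) p) q :
      ℂ × E →L[ℂ] ℂ × E) X =
    (chartDeriv (E := ℂ) p.1 q.1 X.1, chartDeriv (E := E) p.2 q.2 X.2) := by
  have h3 := mfderiv_prodMap ((contMDiffAt_chartAt (E := ℂ) h1).mdifferentiableAt (by simp))
    ((contMDiffAt_chartAt (E := E) h2).mdifferentiableAt (by simp))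
  rw [modelWithCornersSelf_prod, ← chartedSpaceSelf_prod]
  exact congrArg (fun T : (ℂ × E) →L[ℂ] (ℂ × E) => T X) h3

end ProductChart

namespace AutomorphicSystem

variable {S : Type*} [TopologicalSpace S] [ChartedSpace ℂ S]
  {E : Type v} [NormedAddCommGroup E] [NormedSpace ℂ E]
  {G : Type u} [TopologicalSpace G] [ChartedSpace E G] [Group G]

/-- The right-invariant fields of the system as vectors of the model space `E`, which carries the
norm that the Lie algebra, as a tangent space, lacks. -/
def generator (𝒜 : AutomorphicSystem S E G) (i : Fin 𝒜.n) : E :=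
  𝒜.A i

lemma sum_smul_fundamentalField_adjointRep [LieGroup 𝓘(ℂ, E) ω G]
    (𝒜 : AutomorphicSystem S E G) (t : S) (w : E) :
    (∑ i, 𝒜.f i t • fundamentalField (F := E) (fun (g : G) (x : E) => adjointRep E G g x)
      (𝒜.A i) w : E) = lieAd G (∑ i, 𝒜.f i t • 𝒜.generator i) w := by
  rw [map_sum, sum_apply]
  refine Finset.sum_congr rfl fun i _ => ?_
  rw [map_smul, smul_apply]
  exact congrArg (𝒜.f i t • ·) (fundamentalField_adjointRep (𝒜.A i) w)

variable [IsManifold 𝓘(ℂ, ℂ) ω S] [LieGroup 𝓘(ℂ, E) ω G]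

lemma differentiableAt_inCoord {W : Type*} [NormedAddCommGroup W] [NormedSpace ℂ W] {x : S → W}
    {t : S} (hx : ContMDiffAt 𝓘(ℂ, ℂ) 𝓘(ℂ, W) ω x t) :
    DifferentiableAt ℂ (inCoord x t) (chartAt ℂ t t) :=
  ((contMDiffAt_comp_chartAt_symm hx (mem_chart_source ℂ t)).contDiffAt).differentiableAt (by simp)

/-- The commutation relation of a transversal right-invariant symmetry is the Lie–Vessiot equation
of the adjoint representation for its values at the identity. -/
lemma IsRight.del_smul_deriv {𝒜 : AutomorphicSystem S E G}
    {L : ∀ p : S × G, TangentSpace (𝓘(ℂ, ℂ).prod 𝓘(ℂ, E)) p} (hL : 𝒜.IsRight L) {t : S}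
    (ht : t ∈ 𝒜.regularSet) :
    fieldInCoord 𝒜.del t (chartAt ℂ t t) •
        deriv (inCoord (fibreValue (E := E) L) t) (chartAt ℂ t t) =
      lieAd (E := E) G (∑ i, 𝒜.f i t • 𝒜.generator i) (fibreValue (E := E) L t) := by
  set u := inCoord (fibreValue (E := E) L) t with hu
  set b : ℂ → E := fun z => ∑ i, inCoord (𝒜.f i) t z • 𝒜.generator i with hb
  have hud : DifferentiableAt ℂ u (chartAt ℂ t t) := differentiableAt_inCoord (hL.holomorphic t ht)
  have hbd : DifferentiableAt ℂ b (chartAt ℂ t t) := by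
    refine DifferentiableAt.fun_sum fun i _ => ?_
    exact ((𝒜.contDiffAt_f ht i).differentiableAt (by simp)).smul_const _
  have hcd := (𝒜.contDiffAt_del ht).differentiableAt (by simp)
  have hnhds : ∀ᶠ p : ℂ × E in 𝓝 (chartAt ℂ t t, chartAt E (1 : G) 1),
      ((chartAt ℂ t).symm p.1 ∈ 𝒜.regularSet ∧ p.1 ∈ (chartAt ℂ t).target) ∧
        p.2 ∈ (chartAt E (1 : G)).target :=
    ((eventually_chartAt_symm (mem_chart_source ℂ t) (𝒜.eventually_mem_regularSet ht)).and
      (eventually_mem_chart_target t)).prod_nhds (eventually_mem_chart_target (1 : G))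
  have : IsManifold (𝓘(ℂ, ℂ).prod 𝓘(ℂ, E)) 1 (S × G) := IsManifold.of_le (n := ω) (by simp)
  have h := lieBracket_eq_zero_of_mlieBracket_eq_zero (hL.symmetry.commutes t ht 1)
    (X' := fun p : ℂ × E => ((0 : ℂ), rightFrame G p.2 (u p.1)))
    (Y' := fun p : ℂ × E => (fieldInCoord 𝒜.del t p.1, rightFrame G p.2 (b p.1))) ?_ ?_
  · have h2 := congrArg Prod.snd h
    have h3 := (lieBracket_rightFrame (G := G) hud hbd hcd).symm.trans h2
    rw [← sub_eq_zero.1 h3]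
    simp only [hb, hu, inCoord, chartAt_symm_chartAt_self]
  · filter_upwards [hnhds] with p ⟨⟨hs, hst⟩, hg⟩
    set s := (chartAt ℂ t).symm p.1 with hsdef
    set g := (chartAt E (1 : G)).symm p.2 with hgdef
    have hg' : g ∈ (chartAt E (1 : G)).source := (chartAt E (1 : G)).map_target hg
    have e1 := hL.symmetry.transversal s hs g
    have e2 := hL.right_invariant s hs g
    have e3 := chartDeriv_rightInvariantField hg' (fibreValue (E := E) L s)
    rw [hgdef, (chartAt E (1 : G)).right_inv hg, ← hgdef] at e3
    refine Eq.trans ?_ (mfderiv_extChartAt_prod_apply (p := (t, (1 : G))) (q := (s, g))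
      ((chartAt ℂ t).map_target hst) hg' (L (s, g))).symm
    refine Prod.ext ?_ ?_
    · exact ((congrArg (chartDeriv (E := ℂ) t s) e1).trans (map_zero _)).symm
    · exact ((congrArg (chartDeriv (E := E) (1 : G) g) e2).trans e3).symm
  · filter_upwards [hnhds] with p ⟨⟨hs, hst⟩, hg⟩
    set s := (chartAt ℂ t).symm p.1 with hsdef
    set g := (chartAt E (1 : G)).symm p.2 with hgdef
    have hg' : g ∈ (chartAt E (1 : G)).source := (chartAt E (1 : G)).map_target hg
    refine Eq.trans ?_ (mfderiv_extChartAt_prod_apply (p := (t, (1 : G))) (q := (s, g))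
      ((chartAt ℂ t).map_target hst) hg' (𝒜.field (s, g))).symm
    refine Prod.ext rfl ?_
    have e3 : ∀ i, rightFrame G p.2 (𝒜.generator i) =
        chartDeriv (E := E) (1 : G) g (rightInvariantField (𝒜.A i) g) := by
      intro i
      rw [chartDeriv_rightInvariantField hg' (𝒜.A i), hgdef, (chartAt E (1 : G)).right_inv hg]
      rfl
    have e4 : rightFrame G p.2 (b p.1) = ∑ i, 𝒜.f i s • rightFrame G p.2 (𝒜.generator i) := by
      simp only [hb, map_sum, map_smul]
      rfl
    refine e4.trans ?_
    simp only [e3]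
    exact ((map_sum (chartDeriv (E := E) (1 : G) g) _ _).trans
      (Finset.sum_congr rfl fun i _ => map_smul (chartDeriv (E := E) (1 : G) g) _ _)).symm

/-- The values at the identity of a transversal right-invariant symmetry solve the Lie–Vessiot
system of the adjoint representation. -/
lemma IsRight.isSolution {𝒜 : AutomorphicSystem S E G}
    {L : ∀ p : S × G, TangentSpace (𝓘(ℂ, ℂ).prod 𝓘(ℂ, E)) p} (hL : 𝒜.IsRight L) :
    𝒜.IsSolution (F := E) (fun (g : G) (x : E) => adjointRep E G g x)
      (fibreValue (E := E) L) := by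
  refine ⟨hL.holomorphic, fun t ht => ?_⟩
  have h1 := mfderiv_eq_fderiv_comp_chartDeriv (hL.holomorphic t ht) (mem_chart_source ℂ t)
  rw [chartDeriv_self] at h1
  have h2 := congrArg (fun T : ℂ →L[ℂ] E => T (𝒜.del t)) h1
  have h3 : fderiv ℂ (inCoord (fibreValue (E := E) L) t) (chartAt ℂ t t) (𝒜.del t) =
      fieldInCoord 𝒜.del t (chartAt ℂ t t) •
        deriv (inCoord (fibreValue (E := E) L) t) (chartAt ℂ t t) := by
    rw [fieldInCoord_self]
    exact fderiv_eq_smul_deriv _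
  refine h2.trans (h3.trans ((hL.del_smul_deriv ht).trans
    (𝒜.sum_smul_fundamentalField_adjointRep t _).symm))

/-- Near a point of `S^×`, a solution of the adjoint Lie–Vessiot system stays in one orbit. -/
lemma IsSolution.eventually_exists_adjointMap_eq [CompleteSpace E] {𝒜 : AutomorphicSystem S E G}
    {x : S → E} (hx : 𝒜.IsSolution (F := E) (fun (g : G) (x : E) => adjointRep E G g x) x) {t : S}
    (ht : t ∈ 𝒜.regularSet) : ∀ᶠ s in 𝓝 t, ∃ g : G, adjointMap g (x t) = x s := by
  set u := inCoord x t with hu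
  set c := fieldInCoord 𝒜.del t with hc
  -- in the coordinate `z` the system `∂x = ∑ fᵢ [Aᵢ, x]`, with `∂ = c d/dz`, is `x' = [a, x]`
  set a : ℂ → E := fun z => (c z)⁻¹ • ∑ i, inCoord (𝒜.f i) t z • 𝒜.generator i with ha
  have hcd := 𝒜.contDiffAt_del ht
  have hc0 := 𝒜.fieldInCoord_del_ne_zero ht
  have had : ContDiffAt ℂ 1 a (chartAt ℂ t t) := by
    refine ContDiffAt.of_le (n := ω) ?_ le_top
    refine (hcd.inv hc0).smul (ContDiffAt.sum fun i _ => ?_)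
    exact (𝒜.contDiffAt_f ht i).smul contDiffAt_const
  have hode : ∀ᶠ z in 𝓝 (chartAt ℂ t t), HasDerivAt u (lieAd G (a z) (u z)) z := by
    filter_upwards [hcd.continuousAt.eventually_ne hc0, eventually_mem_chart_target t,
      eventually_chartAt_symm (mem_chart_source ℂ t) (𝒜.eventually_mem_regularSet ht)]
      with z hz hzt hzr
    obtain ⟨s, hs, rfl⟩ : ∃ s ∈ (chartAt ℂ t).source, chartAt ℂ t s = z :=
      ⟨_, (chartAt ℂ t).map_target hzt, (chartAt ℂ t).right_inv hzt⟩
    rw [(chartAt ℂ t).left_inv hs] at hzr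
    have hud : DifferentiableAt ℂ u (chartAt ℂ t s) :=
      (contMDiffAt_comp_chartAt_symm (hx.1 s hzr) hs).contDiffAt.differentiableAt (by simp)
    have h1 := mfderiv_eq_fderiv_comp_chartDeriv (hx.1 s hzr) hs
    have h2 := congrArg (fun T : ℂ →L[ℂ] E => T (𝒜.del s)) h1
    have h3 : fderiv ℂ u (chartAt ℂ t s) (chartDeriv (E := ℂ) t s (𝒜.del s)) =
        c (chartAt ℂ t s) • deriv u (chartAt ℂ t s) := by
      rw [hc, fieldInCoord_chartAt 𝒜.del hs]
      exact fderiv_eq_smul_deriv _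
    have h4 := (h3.symm.trans h2.symm).trans ((hx.2 s hzr).trans
      (𝒜.sum_smul_fundamentalField_adjointRep s (x s)))
    have h5 : lieAd G (a (chartAt ℂ t s)) (u (chartAt ℂ t s)) = deriv u (chartAt ℂ t s) := by
      have h6 : deriv u (chartAt ℂ t s) = (c (chartAt ℂ t s))⁻¹ •
          lieAd G (∑ i, 𝒜.f i s • 𝒜.generator i) (x s) := by
        rw [eq_inv_smul_iff₀ hz]
        exact h4
      rw [h6]
      simp [ha, hu, inCoord, (chartAt ℂ t).left_inv hs]
    rw [h5]
    exact hud.hasDerivAt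
  have h := eventually_chartAt (mem_chart_source ℂ t)
    (LieVessiot.eventually_exists_adjointMap_eq had hode)
  filter_upwards [h, (chartAt ℂ t).open_source.mem_nhds (mem_chart_source ℂ t)] with s hs hst
  simpa [hu, inCoord, (chartAt ℂ t).left_inv hst] using hs

/-- A solution over `S^×` of the adjoint Lie–Vessiot system lies in a single orbit. -/
lemma IsSolution.exists_adjointMap_eq [CompleteSpace E] [ConnectedSpace S]
    {𝒜 : AutomorphicSystem S E G} {x : S → E}
    (hx : 𝒜.IsSolution (F := E) (fun (g : G) (x : E) => adjointRep E G g x) x) {t : S}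
    (ht : t ∈ 𝒜.regularSet) : ∀ s ∈ 𝒜.regularSet, ∃ g : G, adjointMap g (x t) = x s := by
  obtain ⟨O, hO⟩ := exists_eq_of_locallyConstant_of_nhdsNE
    (φ := fun s => Set.range fun g : G => adjointMap g (x s))
    𝒜.eventually_nhdsNE_mem_regularSet (fun t ht => by
      filter_upwards [hx.eventually_exists_adjointMap_eq ht] with s ⟨g, hg⟩
      rw [← hg]
      have e : (fun h : G => adjointMap h (adjointMap g (x t))) =
          (fun h : G => adjointMap h (x t)) ∘ fun h => h * g := by
        funext h
        exact congrArg (fun T : E →L[ℂ] E => T (x t)) (adjointMap_mul h g).symm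
      rw [e]
      exact (Equiv.mulRight g).surjective.range_comp (fun h : G => adjointMap h (x t)))
  intro s hs
  have h : x s ∈ Set.range fun g : G => adjointMap g (x s) :=
    ⟨1, congrArg (fun T : E →L[ℂ] E => T (x s)) adjointMap_one⟩
  rw [show (Set.range fun g : G => adjointMap g (x s)) = _ from (hO s hs).trans (hO t ht).symm] at h
  exact h

end AutomorphicSystem

end LieVessiot

theorem mainTheorem7
    {S : Type*} [TopologicalSpace S] [T2Space S] [ConnectedSpace S]
    [ChartedSpace ℂ S] [IsManifold 𝓘(ℂ, ℂ) ω S]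
    {E : Type v} [NormedAddCommGroup E] [NormedSpace ℂ E] [FiniteDimensional ℂ E]
    {G : Type u} [TopologicalSpace G] [T2Space G] [ConnectedSpace G]
    [ChartedSpace E G] [Group G] [LieGroup 𝓘(ℂ, E) ω G]
    (𝒜 : LieVessiot.AutomorphicSystem S E G) (t : S) (ht : t ∈ 𝒜.regularSet) :
    (𝒜.Gal t : Set G) ⊆ LieVessiot.centralizer (𝒜.rightAt t) := by
  rintro g hg X ⟨L, hL, rfl⟩
  have : CompleteSpace E := FiniteDimensional.complete ℂ E
  -- the realization is the adjoint representation, with a point as manifold factor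
  have hsol := hL.isSolution
  have hmer : 𝒜.IsMeromorphicHomogeneousSolution (F := PUnit.{u + 1}) (N := PUnit.{u + 1})
      (LieVessiot.adjointRep E G) (fun _ => PUnit.unit)
      (LieVessiot.AutomorphicSystem.fibreValue (E := E) L) :=
    { solution_left := ⟨fun _ _ => contMDiffAt_const, fun _ _ => rfl⟩
      solution_right := hsol
      homogeneous := ⟨PUnit.unit, LieVessiot.AutomorphicSystem.fibreValue (E := E) L t,
        fun s hs => (hsol.exists_adjointMap_eq ht s hs).imp fun _ h => ⟨rfl, h⟩⟩
      holomorphic := contMDiff_const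
      meromorphic := hL.meromorphic }
  have h := hg PUnit.{u + 1} PUnit.{u + 1} contMDiff_const E (LieVessiot.adjointRep E G)
    LieVessiot.contMDiff_adjointRep (fun _ => PUnit.unit)
    (LieVessiot.AutomorphicSystem.fibreValue (E := E) L) hmer
  exact (LieVessiot.Adj_eq_adjointMap g _).trans h.2
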